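/- Let $(M,g)$ and $(\bar M,\bar g)$ be smooth finite-dimensional Riemannian manifolds without boundary, equipped with smooth distributions (subbundles of the tangent bundle) ${\cal D}\subset TM$ of rank $d$ and $\bar{\cal D}\subset T\bar M$. Let $f:M\to\bar M$ be an isometric immersion that is adapted, i.e. $f_*({\cal D})\subset\bar{\cal D}$ along $f$. Let $k\ge 2$, and let $n_1,\dots,n_k\ge 1$ be integers with $s:=\sum_i n_i\le d$. Notation. $K$ is the sectional curvature of the Levi-Civita connection of $g$. For mutually orthogonal subspaces $V_1,\dots,V_k$ of $T_xM$, the mutual curvature is ${\rm S}_{\rm m}(V_1,\dots,V_k)=\sum_{i<j}\sum_{a,b}K(e_a\wedge e_b)$, where $e_a$ and $e_b$ run over orthonormal bases of $V_i$ and $V_j$, respectively. Put $\delta^+_{{\rm m},{\cal D}}(n_1,\dots,n_k)(x)=\max {\rm S}_{\rm m}(V_1,\dots,V_k)$ over all mutually orthogonal subspaces $V_1,\dots,V_k$ of ${\cal D}_x$ with $\dim V_i=n_i$. The quantities $\bar{\rm S}_{\rm m}$ and $\bar\delta^+_{{\rm m},\bar{\cal D}}$ are defined in the same way for $(\bar M,\bar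 g,\bar{\cal D})$. Let $\bar h$ be the second fundamental form of $f$ (the normal component of the ambient Levi-Civita derivative). For a subspace $V\subset T_xM$ let $\bar H_V=\sum_a\bar h(e_a,e_a)$, with $(e_a)$ an orthonormal basis of $V$; write $\bar H_{\cal D}(x)=\bar H_{{\cal D}_x}$ and ${\cal H}_{{\cal D}_x}(s)=\max\{\|\bar H_V\|: V\subset{\cal D}_x,\ \dim V=s\}$. All these maxima are attained. Then at every point $x\in M$, with $\bar\delta^+_{{\rm m},\bar{\cal D}}$ taken at $f(x)$, $$\delta^+_{{\rm m},{\cal D}}(n_1,\dots,n_k)\le\bar\delta^+_{{\rm m},\bar{\cal D}}(n_1,\dots,n_k)+\frac{k-1}{2k}\begin{cases}{\cal H}_{{\cal D}_x}(s)^2,& s<d,\\ \|\bar H_{\cal D}\|^2,& s=d.\end{cases}$$ Equality holds at $x$ if and only if there are mutually orthogonal subspaces $V_1,\dots,V_k$ of ${\cal D}_x$ with $\dim V_i=n_i$ such that, writing $V=\bigoplus_iV_i$: $f$ is mixed totally geodesic on $V$, i.e. $\bar h(X,Y)=0$ for all $X\in V_i$, $Y\in V_j$, $i\ne j$; $\bar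 H_{V_1}=\dots=\bar H_{V_k}$; $\|\bar H_V\|={\cal H}_{{\cal D}_x}(s)$; and $\bar{\rm S}_{\rm m}(f_*V_1,\dots,f_*V_k)=\bar\delta^+_{{\rm m},\bar{\cal D}}(n_1,\dots,n_k)(f(x))$. -/

import Mathlib

open Bundle Manifold
open scoped ContDiff

/-! ### The Levi-Civita connection and curvature of a metric on a vector space

`G y` is the value at `y : E` of a Riemannian metric on (an open subset of) the vector space `E`. -/

/-- The Christoffel symbol of `G` at `y`: the vector `Γ(u, v)` such that, for all `w`,
`G (Γ(u, v), w) = (∂_u G(v, w) + ∂_v G(u, w) - ∂_w G(u, v)) / 2`. -/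
noncomputable def christoffel {E : Type*} [NormedAddCommGroup E] [NormedSpace ℝ E]
    (G : E → E →L[ℝ] E →L[ℝ] ℝ) (y u v : E) : E :=
  (G y).inverse ((1 / 2 : ℝ) •
    (fderiv ℝ G y u v + fderiv ℝ G y v u - ((fderiv ℝ G y).flip u).flip v))

/-- The Levi-Civita covariant derivative `∇_X Y` of vector fields on `E` with the metric `G`. -/
noncomputable def covDeriv {E : Type*} [NormedAddCommGroup E] [NormedSpace ℝ E]
    (G : E → E →L[ℝ] E →L[ℝ] ℝ) (X Y : E → E) (y : E) : E :=
  fderiv ℝ Y y (X y) + christoffel G y (X y) (Y y)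

/-- The curvature `R_{u,v} w = ∇_u ∇_v w - ∇_v ∇_u w` of the metric `G` at `y`, where the vectors
`u, v, w` are extended to constant vector fields (so that `[u, v] = 0`). -/
noncomputable def chartCurvature {E : Type*} [NormedAddCommGroup E] [NormedSpace ℝ E]
    (G : E → E →L[ℝ] E →L[ℝ] ℝ) (y u v w : E) : E :=
  covDeriv G (fun _ ↦ u) (covDeriv G (fun _ ↦ v) (fun _ ↦ w)) y -
    covDeriv G (fun _ ↦ v) (covDeriv G (fun _ ↦ u) (fun _ ↦ w)) y

/-! ### Riemannian manifolds -/

section Manifold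

variable {E : Type*} [NormedAddCommGroup E] [NormedSpace ℝ E] [FiniteDimensional ℝ E]
  {M : Type*} [TopologicalSpace M] [ChartedSpace E M]

instance tangentSpace_finiteDimensional (x : M) :
    FiniteDimensional ℝ (TangentSpace 𝓘(ℝ, E) x) :=
  inferInstanceAs (FiniteDimensional ℝ E)

/-- A smooth distribution of rank `d` on `M`: a subspace of every tangent space, locally spanned by
`d` smooth pointwise linearly independent vector fields. -/
structure SmoothDistribution (E : Type*) [NormedAddCommGroup E] [NormedSpace ℝ E]
    (M : Type*) [TopologicalSpace M] [ChartedSpace E M] [IsManifold 𝓘(ℝ, E) ∞ M] (d : ℕ) where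
  fiber : ∀ x : M, Submodule ℝ (TangentSpace 𝓘(ℝ, E) x)
  exists_localFrame : ∀ x : M, ∃ U : Set M, IsOpen U ∧ x ∈ U ∧
    ∃ X : Fin d → ∀ y : M, TangentSpace 𝓘(ℝ, E) y,
      (∀ i, ContMDiffOn 𝓘(ℝ, E) 𝓘(ℝ, E).tangent ∞
        (fun y ↦ (⟨y, X i y⟩ : TangentBundle 𝓘(ℝ, E) M)) U) ∧
      ∀ y ∈ U, LinearIndependent ℝ (fun i ↦ X i y) ∧
        Submodule.span ℝ (Set.range fun i ↦ X i y) = fiber y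

variable [IsManifold 𝓘(ℝ, E) ∞ M] [RiemannianBundle (fun x : M ↦ TangentSpace 𝓘(ℝ, E) x)]

/-- The Riemannian metric of `M` read in the preferred chart at `x`, i.e. its pullback under the
inverse of this chart. The tangent space at `x` is identified with `E` by the same chart. -/
noncomputable def chartMetric (x : M) (y : E) : E →L[ℝ] E →L[ℝ] ℝ :=
  let A : E →L[ℝ] TangentSpace 𝓘(ℝ, E) ((extChartAt 𝓘(ℝ, E) x).symm y) :=
    mfderiv 𝓘(ℝ, E) 𝓘(ℝ, E) (extChartAt 𝓘(ℝ, E) x).symm y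
  (innerSL ℝ).bilinearComp A A

/-- The Riemannian curvature tensor `R_{u,v} w` at `x`. -/
noncomputable def riemannCurvature (x : M) (u v w : TangentSpace 𝓘(ℝ, E) x) :
    TangentSpace 𝓘(ℝ, E) x :=
  chartCurvature (chartMetric (E := E) x) (extChartAt 𝓘(ℝ, E) x x) u v w

/-- `g(R_{u,v} v, u)`: the sectional curvature of `u ∧ v` for an orthonormal pair `u, v`. -/
noncomputable def sectionalCurvature (x : M) (u v : TangentSpace 𝓘(ℝ, E) x) : ℝ :=
  inner ℝ (riemannCurvature x u v v) u

/-- The mutual curvature of `V₁, …, V_k`: the sum over `i < j` of the sectional curvatures of the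
planes `e_a ∧ e_b`, with `e_a` and `e_b` running over orthonormal bases of `V_i` and `V_j`. -/
noncomputable def mutualCurvature {k : ℕ} (x : M)
    (V : Fin k → Submodule ℝ (TangentSpace 𝓘(ℝ, E) x)) : ℝ :=
  ∑ i, ∑ j, if i < j then
    ∑ a, ∑ b, sectionalCurvature x
      (stdOrthonormalBasis ℝ (V i) a : TangentSpace 𝓘(ℝ, E) x)
      (stdOrthonormalBasis ℝ (V j) b : TangentSpace 𝓘(ℝ, E) x)
  else 0

/-- `V₁, …, V_k` are mutually orthogonal subspaces of `W ⊆ T_x M` of dimensions `n₁, …, n_k`. -/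
def IsOrthogonalTuple {k : ℕ} (x : M) (W : Submodule ℝ (TangentSpace 𝓘(ℝ, E) x)) (n : Fin k → ℕ)
    (V : Fin k → Submodule ℝ (TangentSpace 𝓘(ℝ, E) x)) : Prop :=
  (∀ i, V i ≤ W) ∧ (∀ i, Module.finrank ℝ (V i) = n i) ∧
    ∀ i j, i ≠ j → ∀ u ∈ V i, ∀ v ∈ V j, inner ℝ u v = 0

/-- The values of the mutual curvature over the mutually orthogonal `k`-tuples of subspaces of `W`
of dimensions `n₁, …, n_k`. -/
def mutualCurvatureValues {k : ℕ} (x : M) (W : Submodule ℝ (TangentSpace 𝓘(ℝ, E) x))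
    (n : Fin k → ℕ) : Set ℝ :=
  {S | ∃ V, IsOrthogonalTuple x W n V ∧ S = mutualCurvature x V}

/-- The invariant `δ⁺_{m,W}(n₁, …, n_k)` at `x`, where `W` is the value at `x` of a distribution. -/
noncomputable def deltaPlus {k : ℕ} (x : M) (W : Submodule ℝ (TangentSpace 𝓘(ℝ, E) x))
    (n : Fin k → ℕ) : ℝ :=
  sSup (mutualCurvatureValues x W n)

end Manifold

/-! ### Isometric immersions -/

section Immersion

variable {E : Type*} [NormedAddCommGroup E] [NormedSpace ℝ E] [FiniteDimensional ℝ E]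
  {M : Type*} [TopologicalSpace M] [ChartedSpace E M] [IsManifold 𝓘(ℝ, E) ∞ M]
  [RiemannianBundle (fun x : M ↦ TangentSpace 𝓘(ℝ, E) x)]
  {E' : Type*} [NormedAddCommGroup E'] [NormedSpace ℝ E'] [FiniteDimensional ℝ E']
  {M' : Type*} [TopologicalSpace M'] [ChartedSpace E' M'] [IsManifold 𝓘(ℝ, E') ∞ M']
  [RiemannianBundle (fun x : M' ↦ TangentSpace 𝓘(ℝ, E') x)]

/-- A smooth map pulling the metric of `M'` back to that of `M` (its differentials are then
injective, hence it is an immersion). -/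
def IsIsometricImmersion (f : M → M') : Prop :=
  ContMDiff 𝓘(ℝ, E) 𝓘(ℝ, E') ∞ f ∧
    ∀ (x : M) (u v : TangentSpace 𝓘(ℝ, E) x),
      inner ℝ (mfderiv 𝓘(ℝ, E) 𝓘(ℝ, E') f x u) (mfderiv 𝓘(ℝ, E) 𝓘(ℝ, E') f x v) = inner ℝ u v

/-- The covariant derivative `∇'_u (f_* v)` of the ambient Levi-Civita connection along `f` at `x`,
where `v` is extended to a vector field on `M` that is constant in the preferred chart at `x`. -/
noncomputable def ambientDeriv (f : M → M') (x : M) (u v : TangentSpace 𝓘(ℝ, E) x) :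
    TangentSpace 𝓘(ℝ, E') (f x) :=
  let F : E → E' := writtenInExtChartAt 𝓘(ℝ, E) 𝓘(ℝ, E') x f
  let y : E := extChartAt 𝓘(ℝ, E) x x
  let u₀ : E := u
  let v₀ : E := v
  (fderiv ℝ (fun z ↦ fderiv ℝ F z v₀) y u₀ +
    christoffel (chartMetric (E := E') (f x)) (F y) (fderiv ℝ F y u₀) (fderiv ℝ F y v₀) : E')

/-- The component of `w` normal to `f_* (T_x M)`, for an isometric immersion `f`: the vector
`w - ∑ₐ ⟨f_* eₐ, w⟩ f_* eₐ` for an orthonormal basis `(eₐ)` of `T_x M`. -/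
noncomputable def normalPart (f : M → M') (x : M) (w : TangentSpace 𝓘(ℝ, E') (f x)) :
    TangentSpace 𝓘(ℝ, E') (f x) :=
  w - ∑ a, (inner ℝ (mfderiv 𝓘(ℝ, E) 𝓘(ℝ, E') f x
      (stdOrthonormalBasis ℝ (TangentSpace 𝓘(ℝ, E) x) a)) w : ℝ) •
    mfderiv 𝓘(ℝ, E) 𝓘(ℝ, E') f x (stdOrthonormalBasis ℝ (TangentSpace 𝓘(ℝ, E) x) a)

/-- The second fundamental form `h(u, v) = (∇'_u v)^⊥` of the isometric immersion `f` at `x`. -/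
noncomputable def secondFundamentalForm (f : M → M') (x : M) (u v : TangentSpace 𝓘(ℝ, E) x) :
    TangentSpace 𝓘(ℝ, E') (f x) :=
  normalPart (E := E) f x (ambientDeriv f x u v)

/-- The mean curvature vector `H_V = ∑ₐ h(eₐ, eₐ)` of a subspace `V ⊆ T_x M`, for an orthonormal
basis `(eₐ)` of `V`. -/
noncomputable def meanCurvature (f : M → M') (x : M)
    (V : Submodule ℝ (TangentSpace 𝓘(ℝ, E) x)) : TangentSpace 𝓘(ℝ, E') (f x) :=
  ∑ a, secondFundamentalForm f x (stdOrthonormalBasis ℝ V a : TangentSpace 𝓘(ℝ, E) x)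
    (stdOrthonormalBasis ℝ V a : TangentSpace 𝓘(ℝ, E) x)

/-- The values `‖H_V‖` over the `s`-dimensional subspaces `V` of `W`. -/
def meanCurvatureNorms (f : M → M') (x : M) (W : Submodule ℝ (TangentSpace 𝓘(ℝ, E) x))
    (s : ℕ) : Set ℝ :=
  {r | ∃ V : Submodule ℝ (TangentSpace 𝓘(ℝ, E) x),
    V ≤ W ∧ Module.finrank ℝ V = s ∧ r = ‖meanCurvature (E' := E') f x V‖}

/-- `𝓗_W(s)`, where `W` is the value at `x` of a distribution. -/
noncomputable def maxMeanCurvature (f : M → M') (x : M)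
    (W : Submodule ℝ (TangentSpace 𝓘(ℝ, E) x)) (s : ℕ) : ℝ :=
  sSup (meanCurvatureNorms (E' := E') f x W s)

/-- `f` is mixed totally geodesic on the sum of `V₁, …, V_k`. -/
def IsMixedTotallyGeodesic {k : ℕ} (f : M → M') (x : M)
    (V : Fin k → Submodule ℝ (TangentSpace 𝓘(ℝ, E) x)) : Prop :=
  ∀ i j, i ≠ j → ∀ u ∈ V i, ∀ v ∈ V j, secondFundamentalForm (E' := E') f x u v = 0

/-- The right-hand side of the inequality at the point `x`. -/
noncomputable def curvatureBound {d d' k : ℕ} (f : M → M') (D : SmoothDistribution E M d)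
    (D' : SmoothDistribution E' M' d') (n : Fin k → ℕ) (x : M) : ℝ :=
  deltaPlus (f x) (D'.fiber (f x)) n + ((k : ℝ) - 1) / (2 * k) *
    (if ∑ i, n i < d then maxMeanCurvature (E' := E') f x (D.fiber x) (∑ i, n i) ^ 2
      else ‖meanCurvature (E' := E') f x (D.fiber x)‖ ^ 2)

end Immersion

/-! The theorem is the Gauss equation, K(u, v) = K'(f_*u, f_*v) + ⟨h(u,u), h(v,v)⟩ - ‖h(u,v)‖²,
summed over mixed pairs of an orthonormal frame adapted to V₁, …, V_k. With H_i the trace of h on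
V_i and H = ∑ H_i, the middle terms add up to ∑_{i<j} ⟨H_i, H_j⟩ = (k-1)/(2k) ‖H‖² - ½ ∑ ‖H_i -
H/k‖² (`sum_sum_lt_inner_eq`).

Hence (`mutualSum_eq_of_gauss`) S_m(V) = S'_m(f_*V) + (k-1)/(2k) ‖H‖² - ½ ∑ ‖H_i - H/k‖² - (squared
norm of the mixed part of h). Here S'_m(f_*V) ≤ δ', because f_*V is admissible for D', and ‖H‖ is at
most the maximal mean curvature, because ⨁ V_i is an s-dimensional subspace of D. Applied to a V
attaining δ, this is the inequality. Equality makes every slack vanish, and the vanishing slacks are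
exactly the listed conditions (`sSup_mutualSum_le_of_gauss`). For s = d the only competitor for the
maximal mean curvature is D itself, so the two cases of the bound agree.

The maxima exist because orthonormal frames form a compact set and the traces involved do not depend
on the basis (`OrthonormalBasis.sum_bilin_eq`).

The Gauss equation itself is proved in charts. Curvature is a commutator of covariant derivatives
along a map; expanding it for F (the immersion in charts) and for the identity gives the same
differentiated terms, since these see only tangential components. Only the quadratic terms of
`gauss_equation_chart` remain, and projecting off the tangent space turns them into h. -/

set_option linter.unusedSectionVars false

/-! ### Levi-Civita connection and curvature of a metric in coordinates. -/

section LocalGeometry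

set_option maxSynthPendingDepth 3

variable {E : Type*} [NormedAddCommGroup E] [NormedSpace ℝ E]
  {E' : Type*} [NormedAddCommGroup E'] [NormedSpace ℝ E']

/-- `G` is a smooth Riemannian metric on the open set `U` of the vector space `E`. -/
structure IsRiemannianOn (G : E → E →L[ℝ] E →L[ℝ] ℝ) (U : Set E) : Prop where
  isOpen : IsOpen U
  contDiffOn : ContDiffOn ℝ ∞ G U
  symm : ∀ y ∈ U, ∀ u v, G y u v = G y v u
  pos : ∀ y ∈ U, ∀ u, u ≠ 0 → 0 < G y u u

/-- The first-kind Christoffel symbol as a continuous bilinear map with values in the dual. -/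
noncomputable def lowerChristoffel (G : E → E →L[ℝ] E →L[ℝ] ℝ) (y : E) :
    E →L[ℝ] E →L[ℝ] E →L[ℝ] ℝ :=
  (1 / 2 : ℝ) • (fderiv ℝ G y + (fderiv ℝ G y).flip -
    ((ContinuousLinearMap.flipₗᵢ ℝ E E ℝ : (E →L[ℝ] E →L[ℝ] ℝ) →L[ℝ] (E →L[ℝ] E →L[ℝ] ℝ)).comp
      (fderiv ℝ G y).flip))

/-- The Christoffel symbol as a continuous bilinear map. -/
noncomputable def christoffelL (G : E → E →L[ℝ] E →L[ℝ] ℝ) (y : E) : E →L[ℝ] E →L[ℝ] E :=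
  (ContinuousLinearMap.compL ℝ E (E →L[ℝ] ℝ) E (G y).inverse).comp (lowerChristoffel G y)

/-- Bundling makes the symbol an operator-valued function of the point alone, so that it can be
differentiated as a whole. -/
theorem christoffelL_apply (G : E → E →L[ℝ] E →L[ℝ] ℝ) (y u v : E) :
    christoffelL G y u v = christoffel G y u v := by
  simp [christoffelL, lowerChristoffel, christoffel]

namespace IsRiemannianOn

variable {G : E → E →L[ℝ] E →L[ℝ] ℝ} {U : Set E}

/-- Definiteness makes `G y` injective into a dual of the same dimension. This matters because
`ContinuousLinearMap.inverse` is zero at non-invertible maps. -/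
theorem isInvertible [FiniteDimensional ℝ E] (hG : IsRiemannianOn G U) {y : E} (hy : y ∈ U) :
    (G y).IsInvertible := by
  have hinj : Function.Injective (G y : E →ₗ[ℝ] (E →L[ℝ] ℝ)) := by
    rw [← LinearMap.ker_eq_bot, LinearMap.ker_eq_bot']
    intro m hm
    by_contra h
    have h1 := hG.pos y hy m h
    have h2 : G y m = 0 := hm
    simp [h2] at h1
  have hdim : Module.finrank ℝ E = Module.finrank ℝ (E →L[ℝ] ℝ) := by
    rw [← (LinearMap.toContinuousLinearMap (𝕜 := ℝ) (E := E) (F' := ℝ)).finrank_eq]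
    exact Subspace.dual_finrank_eq.symm
  refine ⟨(LinearEquiv.ofInjectiveOfFinrankEq _ hinj hdim).toContinuousLinearEquiv, ?_⟩
  ext u v
  rfl

theorem eq_of_forall (hG : IsRiemannianOn G U) {y : E} (hy : y ∈ U) {a b : E}
    (h : ∀ w, G y a w = G y b w) : a = b := by
  by_contra hab
  have h1 := hG.pos y hy (a - b) (sub_ne_zero.2 hab)
  have h2 := h (a - b)
  simp only [map_sub, sub_apply] at h1 h2
  linarith

theorem contDiffAt (hG : IsRiemannianOn G U) {y : E} (hy : y ∈ U) : ContDiffAt ℝ ∞ G y :=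
  hG.contDiffOn.contDiffAt (hG.isOpen.mem_nhds hy)

theorem differentiableAt (hG : IsRiemannianOn G U) {y : E} (hy : y ∈ U) :
    DifferentiableAt ℝ G y :=
  (hG.contDiffAt hy).differentiableAt (by simp)

set_option synthInstance.maxHeartbeats 200000 in
theorem contDiffAt_christoffelL [FiniteDimensional ℝ E] (hG : IsRiemannianOn G U) {y : E}
    (hy : y ∈ U) : ContDiffAt ℝ ∞ (christoffelL G) y := by
  have h1 : ContDiffAt ℝ ∞ (fderiv ℝ G) y := (hG.contDiffAt hy).fderiv_right (by simp)
  have h2 : ContDiffAt ℝ ∞ (fun z ↦ (G z).inverse) y :=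
    (hG.isInvertible hy).contDiffAt_map_inverse.comp y (hG.contDiffAt hy)
  have h3 : ContDiffAt ℝ ∞ (fun z ↦ (fderiv ℝ G z).flip) y :=
    (ContinuousLinearMap.flipₗᵢ ℝ E E (E →L[ℝ] ℝ)).contDiff.contDiffAt.comp y h1
  have h4 : ContDiffAt ℝ ∞ (lowerChristoffel G) y :=
    ContDiffAt.const_smul (1 / 2 : ℝ) ((h1.add h3).sub (ContDiffAt.clm_comp (E := E)
      (contDiffAt_const (c := ((ContinuousLinearMap.flipₗᵢ ℝ E E ℝ :
        (E →L[ℝ] E →L[ℝ] ℝ) →L[ℝ] (E →L[ℝ] E →L[ℝ] ℝ))))) h3))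
  unfold christoffelL
  exact (((ContinuousLinearMap.compL ℝ E (E →L[ℝ] ℝ) E).contDiff.contDiffAt.comp y
    h2).clm_comp h4)

theorem differentiableAt_christoffelL [FiniteDimensional ℝ E] (hG : IsRiemannianOn G U) {y : E}
    (hy : y ∈ U) : DifferentiableAt ℝ (christoffelL G) y :=
  (hG.contDiffAt_christoffelL hy).differentiableAt (by simp)

/-- The Koszul formula for constant vector fields. -/
theorem apply_christoffelL [FiniteDimensional ℝ E] (hG : IsRiemannianOn G U) {y : E}
    (hy : y ∈ U) (u v w : E) : G y (christoffelL G y u v) w =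
      (fderiv ℝ G y u v w + fderiv ℝ G y v u w - fderiv ℝ G y w u v) / 2 := by
  obtain ⟨e, he⟩ := hG.isInvertible hy
  rw [christoffelL_apply, christoffel, ← he, ContinuousLinearMap.inverse_equiv]
  simp
  ring

theorem fderiv_apply_apply (hG : IsRiemannianOn G U) {y : E} (hy : y ∈ U) (u v w : E) :
    fderiv ℝ (fun z ↦ G z v w) y u = fderiv ℝ G y u v w := by
  have h := ((hG.differentiableAt hy).hasFDerivAt.clm_apply (hasFDerivAt_const v y)).clm_apply
    (hasFDerivAt_const w y)
  rw [h.fderiv]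
  simp

theorem fderiv_symm (hG : IsRiemannianOn G U) {y : E} (hy : y ∈ U) (u v w : E) :
    fderiv ℝ G y u v w = fderiv ℝ G y u w v := by
  rw [← hG.fderiv_apply_apply hy, ← hG.fderiv_apply_apply hy]
  have : (fun z ↦ G z v w) =ᶠ[nhds y] fun z ↦ G z w v := by
    filter_upwards [hG.isOpen.mem_nhds hy] with z hz using hG.symm z hz v w
  rw [this.fderiv_eq]

/-- The connection is torsion-free. -/
theorem christoffelL_symm [FiniteDimensional ℝ E] (hG : IsRiemannianOn G U) {y : E} (hy : y ∈ U)
    (u v : E) : christoffelL G y u v = christoffelL G y v u :=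
  hG.eq_of_forall hy fun w ↦ by
    rw [hG.apply_christoffelL hy, hG.apply_christoffelL hy, hG.fderiv_symm hy w u v]; ring

/-- The connection is metric: adding the two Koszul formulas cancels all derivatives except the one
in direction `a`. -/
theorem fderiv_eq_christoffelL [FiniteDimensional ℝ E] (hG : IsRiemannianOn G U) {y : E}
    (hy : y ∈ U) (a b c : E) : fderiv ℝ G y a b c =
      G y (christoffelL G y a b) c + G y b (christoffelL G y a c) := by
  rw [hG.symm y hy b, hG.apply_christoffelL hy, hG.apply_christoffelL hy,
    hG.fderiv_symm hy a c b]
  ring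

/-- The curvature in terms of Christoffel symbols. -/
theorem chartCurvature_eq [FiniteDimensional ℝ E] (hG : IsRiemannianOn G U) {y : E} (hy : y ∈ U)
    (u v w : E) : chartCurvature G y u v w =
      fderiv ℝ (christoffelL G) y u v w - fderiv ℝ (christoffelL G) y v u w +
      christoffelL G y u (christoffelL G y v w) - christoffelL G y v (christoffelL G y u w) := by
  have h : ∀ v w, covDeriv G (fun _ ↦ v) (fun _ ↦ w) = fun z ↦ christoffelL G z v w := by
    intro v w
    ext z
    simp [covDeriv, christoffelL_apply]
  have h' : ∀ u v w, fderiv ℝ (fun z ↦ christoffelL G z v w) y u =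
      fderiv ℝ (christoffelL G) y u v w := by
    intro u v w
    rw [(((hG.differentiableAt_christoffelL hy).hasFDerivAt.clm_apply
      (hasFDerivAt_const v y)).clm_apply (hasFDerivAt_const w y)).fderiv]
    simp
  rw [chartCurvature, h, h, covDeriv, covDeriv, h', h', christoffelL_apply, christoffelL_apply]
  simp only [christoffelL_apply]
  abel

theorem mono (hG : IsRiemannianOn G U) {V : Set E} (hV : IsOpen V) (hVU : V ⊆ U) :
    IsRiemannianOn G V where
  isOpen := hV
  contDiffOn := hG.contDiffOn.mono hVU
  symm y hy := hG.symm y (hVU hy)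
  pos y hy := hG.pos y (hVU hy)

/-- Being quadratic in each argument separately is what makes sums of curvatures over frames
independent of the frames. No curvature symmetries are needed: here the last slot is freed to
polarise in `u`, and in the companion lemma the two middle slots polarise in `v`. -/
theorem exists_bilin_chartCurvature_left [FiniteDimensional ℝ E]
    (hG : IsRiemannianOn G U) {y : E} (hy : y ∈ U) (v : E) :
    ∃ b : E →ₗ[ℝ] E →ₗ[ℝ] ℝ, ∀ u, G y (chartCurvature G y u v v) u = b u u := by
  refine ⟨LinearMap.mk₂ ℝ (fun u u' ↦ G y (chartCurvature G y u v v) u') ?_ ?_ ?_ ?_,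
    fun u ↦ rfl⟩
  · intro a b c
    simp only [hG.chartCurvature_eq hy, map_add, map_sub, add_apply, sub_apply]
    ring
  · intro r a c
    simp only [hG.chartCurvature_eq hy, map_add, map_sub, map_smul, add_apply, sub_apply,
      smul_apply, smul_eq_mul]
    ring
  · intro a b c
    rw [map_add]
  · intro r a c
    rw [map_smul]

theorem exists_bilin_chartCurvature_right [FiniteDimensional ℝ E]
    (hG : IsRiemannianOn G U) {y : E} (hy : y ∈ U) (u : E) :
    ∃ b : E →ₗ[ℝ] E →ₗ[ℝ] ℝ, ∀ v, G y (chartCurvature G y u v v) u = b v v := by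
  refine ⟨LinearMap.mk₂ ℝ (fun v w ↦ G y (chartCurvature G y u v w) u) ?_ ?_ ?_ ?_,
    fun u ↦ rfl⟩
  · intro a b c
    simp only [hG.chartCurvature_eq hy, map_add, map_sub, add_apply, sub_apply]
    ring
  · intro r a c
    simp only [hG.chartCurvature_eq hy, map_add, map_sub, map_smul, add_apply, sub_apply,
      smul_apply, smul_eq_mul]
    ring
  · intro a b c
    simp only [hG.chartCurvature_eq hy, map_add, map_sub, add_apply, sub_apply]
    ring
  · intro r a c
    simp only [hG.chartCurvature_eq hy, map_add, map_sub, map_smul, add_apply, sub_apply,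
      smul_apply, smul_eq_mul]
    ring

theorem continuous_chartCurvature [FiniteDimensional ℝ E]
    (hG : IsRiemannianOn G U) {y : E} (hy : y ∈ U) :
    Continuous fun p : E × E ↦ G y (chartCurvature G y p.1 p.2 p.2) p.1 := by
  simp only [hG.chartCurvature_eq hy]
  fun_prop

end IsRiemannianOn

/-- The covariant derivative in the direction `u` of a field `Y` along the map `F`, for the
Levi-Civita connection of `G'`. -/
noncomputable def covDerivAlong (G' : E' → E' →L[ℝ] E' →L[ℝ] ℝ) (F Y : E → E') (u y : E) : E' :=
  fderiv ℝ Y y u + christoffelL G' (F y) (fderiv ℝ F y u) (Y y)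

/-! ### Covariant derivatives along a map. -/

section Along

variable {G' : E' → E' →L[ℝ] E' →L[ℝ] ℝ} {U' : Set E'} {F Y Z : E → E'} {y : E}

/-- By the chain rule the metric is differentiated in the direction F_*u, and metric compatibility
splits that derivative into the Christoffel terms of the two fields. -/
theorem IsRiemannianOn.fderiv_along [FiniteDimensional ℝ E'] (hG' : IsRiemannianOn G' U')
    (hy : F y ∈ U') (hF : DifferentiableAt ℝ F y) (hY : DifferentiableAt ℝ Y y)
    (hZ : DifferentiableAt ℝ Z y) (u : E) :
    fderiv ℝ (fun z ↦ G' (F z) (Y z) (Z z)) y u =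
      G' (F y) (covDerivAlong G' F Y u y) (Z y) + G' (F y) (Y y) (covDerivAlong G' F Z u y) := by
  have h0 : HasFDerivAt (fun z ↦ G' (F z)) ((fderiv ℝ G' (F y)).comp (fderiv ℝ F y)) y :=
    (hG'.differentiableAt hy).hasFDerivAt.comp y hF.hasFDerivAt
  rw [((h0.clm_apply hY.hasFDerivAt).clm_apply hZ.hasFDerivAt).fderiv]
  simp [covDerivAlong, hG'.fderiv_eq_christoffelL hy]
  ring

theorem fderiv_fderiv_apply_comm {V : Type*} [NormedAddCommGroup V] [NormedSpace ℝ V] {Y : E → V}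
    {y : E} (hY : ContDiffAt ℝ ∞ Y y) (u v : E) :
    fderiv ℝ (fun z ↦ fderiv ℝ Y z v) y u = fderiv ℝ (fun z ↦ fderiv ℝ Y z u) y v := by
  have hd : DifferentiableAt ℝ (fderiv ℝ Y) y :=
    (hY.fderiv_right (m := ∞) (by simp)).differentiableAt (by simp)
  have h := fun v ↦ (hd.hasFDerivAt.clm_apply (hasFDerivAt_const v y)).fderiv
  rw [h, h]
  simpa using (hY.isSymmSndFDerivAt (by simpa using (WithTop.coe_le_coe.2 le_top : ((2 : ℕ∞) : ℕ∞ω) ≤ ∞))).eq u v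

/-- Torsion-freeness along F: second derivatives commute and the Christoffel symbol is symmetric. -/
theorem covDerivAlong_fderiv_comm [FiniteDimensional ℝ E'] (hG' : IsRiemannianOn G' U')
    (hy : F y ∈ U') (hF : ContDiffAt ℝ ∞ F y) (u v : E) :
    covDerivAlong G' F (fun z ↦ fderiv ℝ F z v) u y =
      covDerivAlong G' F (fun z ↦ fderiv ℝ F z u) v y := by
  rw [covDerivAlong, covDerivAlong, fderiv_fderiv_apply_comm hF, hG'.christoffelL_symm hy]

theorem ContDiffAt.covDerivAlong [FiniteDimensional ℝ E'] (hG' : IsRiemannianOn G' U')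
    (hy : F y ∈ U') (hF : ContDiffAt ℝ ∞ F y) (hY : ContDiffAt ℝ ∞ Y y) (u : E) :
    ContDiffAt ℝ ∞ (covDerivAlong G' F Y u) y := by
  have h1 : ContDiffAt ℝ ∞ (fun z ↦ fderiv ℝ Y z u) y :=
    (hY.fderiv_right (m := ∞) (by simp)).clm_apply contDiffAt_const
  have h2 : ContDiffAt ℝ ∞ (fun z ↦ fderiv ℝ F z u) y :=
    (hF.fderiv_right (m := ∞) (by simp)).clm_apply contDiffAt_const
  exact h1.add ((((hG'.contDiffAt_christoffelL hy).comp y hF).clm_apply h2).clm_apply hY)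

theorem fderiv_covDerivAlong [FiniteDimensional ℝ E'] (hG' : IsRiemannianOn G' U')
    (hy : F y ∈ U') (hF : ContDiffAt ℝ ∞ F y) (hY : ContDiffAt ℝ ∞ Y y) (u v : E) :
    fderiv ℝ (covDerivAlong G' F Y v) y u =
      fderiv ℝ (fun z ↦ fderiv ℝ Y z v) y u +
      (fderiv ℝ (christoffelL G') (F y) (fderiv ℝ F y u) (fderiv ℝ F y v) (Y y) +
      christoffelL G' (F y) (fderiv ℝ (fun z ↦ fderiv ℝ F z v) y u) (Y y) +
      christoffelL G' (F y) (fderiv ℝ F y v) (fderiv ℝ Y y u)) := by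
  have h1 : ContDiffAt ℝ ∞ (fun z ↦ fderiv ℝ Y z v) y :=
    (hY.fderiv_right (m := ∞) (by simp)).clm_apply contDiffAt_const
  have h2 : ContDiffAt ℝ ∞ (fun z ↦ fderiv ℝ F z v) y :=
    (hF.fderiv_right (m := ∞) (by simp)).clm_apply contDiffAt_const
  have h3 : HasFDerivAt (fun z ↦ christoffelL G' (F z))
      ((fderiv ℝ (christoffelL G') (F y)).comp (fderiv ℝ F y)) y :=
    (hG'.differentiableAt_christoffelL hy).hasFDerivAt.comp y
      (hF.differentiableAt (by simp)).hasFDerivAt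
  have h4 := (h1.differentiableAt (by simp)).hasFDerivAt.add
    ((h3.clm_apply (h2.differentiableAt (by simp)).hasFDerivAt).clm_apply
    (hY.differentiableAt (by simp)).hasFDerivAt)
  have h5 : covDerivAlong G' F Y v = (fun z ↦ fderiv ℝ Y z v) +
    (fun z ↦ christoffelL G' (F z) (fderiv ℝ F z v) (Y z)) := rfl
  rw [h5, h4.fderiv]
  simp
  abel

/-- The curvature is the commutator of covariant derivatives along a map. -/
theorem covDerivAlong_commutator [FiniteDimensional ℝ E'] (hG' : IsRiemannianOn G' U')
    (hy : F y ∈ U') (hF : ContDiffAt ℝ ∞ F y) (hY : ContDiffAt ℝ ∞ Y y) (u v : E) :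
    covDerivAlong G' F (covDerivAlong G' F Y v) u y -
      covDerivAlong G' F (covDerivAlong G' F Y u) v y =
      chartCurvature G' (F y) (fderiv ℝ F y u) (fderiv ℝ F y v) (Y y) := by
  rw [covDerivAlong, covDerivAlong.eq_1 G' F (covDerivAlong G' F Y u),
    fderiv_covDerivAlong hG' hy hF hY, fderiv_covDerivAlong hG' hy hF hY,
    fderiv_fderiv_apply_comm hY u v,
    fderiv_fderiv_apply_comm hF u v, hG'.chartCurvature_eq hy, covDerivAlong, covDerivAlong]
  simp only [map_add]
  abel

/-- Along the identity one recovers the intrinsic connection, so formulas along a map apply to the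
domain metric as well. -/
theorem covDerivAlong_id_const (G : E → E →L[ℝ] E →L[ℝ] ℝ) (u v : E) :
    covDerivAlong G id (fun _ ↦ v) u = fun z ↦ christoffelL G z u v := by
  ext z
  simp [covDerivAlong]

/-- The terms of the Gauss equation before tangential components are removed. -/
theorem IsRiemannianOn.apply_chartCurvature_along [FiniteDimensional ℝ E']
    (hG' : IsRiemannianOn G' U') (hy : ∀ᶠ z in nhds y, F z ∈ U')
    (hF : ∀ᶠ z in nhds y, ContDiffAt ℝ ∞ F z) (u v : E) :
    G' (F y) (chartCurvature G' (F y) (fderiv ℝ F y u) (fderiv ℝ F y v) (fderiv ℝ F y v))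
        (fderiv ℝ F y u) =
      fderiv ℝ (fun z ↦ G' (F z) (covDerivAlong G' F (fun z ↦ fderiv ℝ F z v) v z)
        (fderiv ℝ F z u)) y u -
      fderiv ℝ (fun z ↦ G' (F z) (covDerivAlong G' F (fun z ↦ fderiv ℝ F z v) u z)
        (fderiv ℝ F z u)) y v -
      G' (F y) (covDerivAlong G' F (fun z ↦ fderiv ℝ F z v) v y)
        (covDerivAlong G' F (fun z ↦ fderiv ℝ F z u) u y) +
      G' (F y) (covDerivAlong G' F (fun z ↦ fderiv ℝ F z v) u y)
        (covDerivAlong G' F (fun z ↦ fderiv ℝ F z v) u y) := by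
  have hFy := hF.self_of_nhds
  have hyy := hy.self_of_nhds
  have h2 : ∀ v, ContDiffAt ℝ ∞ (fun z ↦ fderiv ℝ F z v) y := fun v ↦
    (hFy.fderiv_right (m := ∞) (by simp)).clm_apply contDiffAt_const
  have h3 := fun u v ↦ (ContDiffAt.covDerivAlong hG' hyy hFy (h2 v) u).differentiableAt (by simp)
  -- The product rule moves the outer derivative of each half of the commutator onto the pairing
  -- with F_*u; torsion-freeness then replaces ∇_v F_*u by ∇_u F_*v.
  rw [hG'.fderiv_along hyy (hFy.differentiableAt (by simp)) (h3 v v)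
      ((h2 u).differentiableAt (by simp)),
    hG'.fderiv_along hyy (hFy.differentiableAt (by simp)) (h3 u v)
      ((h2 u).differentiableAt (by simp)), covDerivAlong_fderiv_comm hG' hyy hFy v u,
    ← covDerivAlong_commutator hG' hyy hFy (h2 v)]
  simp only [map_sub, sub_apply]
  ring

end Along

/-! ### The Gauss equation for an isometric map between coordinate domains. -/

section Isometric

variable [FiniteDimensional ℝ E] [FiniteDimensional ℝ E'] {G : E → E →L[ℝ] E →L[ℝ] ℝ}
  {U : Set E} {G' : E' → E' →L[ℝ] E' →L[ℝ] ℝ} {U' : Set E'} {F : E → E'} {y : E}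

/-- The tangential component of the ambient derivative is the intrinsic derivative. -/
theorem apply_covDerivAlong_fderiv (hG : IsRiemannianOn G U) (hG' : IsRiemannianOn G' U')
    (hF : ∀ z ∈ U, ContDiffAt ℝ ∞ F z) (hFU : Set.MapsTo F U U')
    (hiso : ∀ z ∈ U, ∀ a b, G' (F z) (fderiv ℝ F z a) (fderiv ℝ F z b) = G z a b)
    (hy : y ∈ U) (u v w : E) :
    G' (F y) (covDerivAlong G' F (fun z ↦ fderiv ℝ F z v) u y) (fderiv ℝ F y w) =
      G y (christoffelL G y u v) w := by
  have hFy := hF y hy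
  have hyy := hFU hy
  have h2 : ∀ v, DifferentiableAt ℝ (fun z ↦ fderiv ℝ F z v) y := fun v ↦
    ((hFy.fderiv_right (m := ∞) (by simp)).clm_apply contDiffAt_const).differentiableAt (by simp)
  -- This differentiates the isometry relation G = F^*G'.
  have key : ∀ u v w, fderiv ℝ G y u v w =
      G' (F y) (covDerivAlong G' F (fun z ↦ fderiv ℝ F z v) u y) (fderiv ℝ F y w) +
      G' (F y) (fderiv ℝ F y v) (covDerivAlong G' F (fun z ↦ fderiv ℝ F z w) u y) := by
    intro u v w
    have h : (fun z ↦ G z v w) =ᶠ[nhds y] fun z ↦ G' (F z) (fderiv ℝ F z v) (fderiv ℝ F z w) := by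
      filter_upwards [hG.isOpen.mem_nhds hy] with z hz using (hiso z hz v w).symm
    rw [← hG'.fderiv_along hyy (hFy.differentiableAt (by simp)) (h2 v) (h2 w),
      ← hG.fderiv_apply_apply hy, h.fderiv_eq]
  -- The Koszul combination of these three derivatives leaves one pairing twice; the others cancel
  -- by torsion-freeness.
  rw [hG.apply_christoffelL hy, key, key, key, covDerivAlong_fderiv_comm hG' hyy hFy v u,
    covDerivAlong_fderiv_comm hG' hyy hFy w u, covDerivAlong_fderiv_comm hG' hyy hFy w v,
    hG'.symm _ hyy (fderiv ℝ F y v), hG'.symm _ hyy (fderiv ℝ F y u)]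
  ring

/-- The Gauss equation in coordinates. -/
theorem gauss_equation_chart (hG : IsRiemannianOn G U) (hG' : IsRiemannianOn G' U')
    (hF : ∀ z ∈ U, ContDiffAt ℝ ∞ F z) (hFU : Set.MapsTo F U U')
    (hiso : ∀ z ∈ U, ∀ a b, G' (F z) (fderiv ℝ F z a) (fderiv ℝ F z b) = G z a b)
    (hy : y ∈ U) (u v : E) :
    G y (chartCurvature G y u v v) u =
      G' (F y) (chartCurvature G' (F y) (fderiv ℝ F y u) (fderiv ℝ F y v) (fderiv ℝ F y v))
        (fderiv ℝ F y u) +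
      (G' (F y) (covDerivAlong G' F (fun z ↦ fderiv ℝ F z v) v y)
        (covDerivAlong G' F (fun z ↦ fderiv ℝ F z u) u y) -
        G y (christoffelL G y v v) (christoffelL G y u u)) -
      (G' (F y) (covDerivAlong G' F (fun z ↦ fderiv ℝ F z v) u y)
        (covDerivAlong G' F (fun z ↦ fderiv ℝ F z v) u y) -
        G y (christoffelL G y u v) (christoffelL G y u v)) := by
  have hU := hG.isOpen.mem_nhds hy
  have e1 := hG'.apply_chartCurvature_along (F := F) (y := y)
    (by filter_upwards [hU] with z hz using hFU hz)
    (by filter_upwards [hU] with z hz using hF z hz) u v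
  have e2 := hG.apply_chartCurvature_along (F := id) (y := y) hU
    (Filter.Eventually.of_forall fun z ↦ contDiffAt_id) u v
  -- The differentiated terms pair ∇'F_*v with a tangent vector, so they are intrinsic and equal
  -- those in the expansion `e2` along the identity. Subtracting the two expansions leaves only
  -- quadratic terms.
  have hc : ∀ a, fderiv ℝ (fun z ↦ G' (F z)
      (covDerivAlong G' F (fun z ↦ fderiv ℝ F z v) a z) (fderiv ℝ F z u)) y =
      fderiv ℝ (fun z ↦ G z (christoffelL G z a v) u) y := by
    intro a
    apply Filter.EventuallyEq.fderiv_eq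
    filter_upwards [hU] with z hz using apply_covDerivAlong_fderiv hG hG' hF hFU hiso hz a v u
  rw [hc, hc] at e1
  simp only [fderiv_id, ContinuousLinearMap.id_apply, covDerivAlong_id_const, id_eq] at e2
  linarith

end Isometric

end LocalGeometry

/-! ### The Riemannian metric of a manifold read in a chart. -/

section ChartMetric

variable {E : Type*} [NormedAddCommGroup E] [NormedSpace ℝ E] [FiniteDimensional ℝ E]
  {M : Type*} [TopologicalSpace M] [ChartedSpace E M] [IsManifold 𝓘(ℝ, E) ∞ M]

/-- The differential of the inverse of the preferred chart at `x`. -/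
noncomputable def chartSymmDeriv (x : M) (y : E) :
    E →L[ℝ] TangentSpace 𝓘(ℝ, E) ((extChartAt 𝓘(ℝ, E) x).symm y) :=
  mfderiv 𝓘(ℝ, E) 𝓘(ℝ, E) (extChartAt 𝓘(ℝ, E) x).symm y

theorem mdifferentiableAt_extChartAt_symm (x : M) {y : E}
    (hy : y ∈ (extChartAt 𝓘(ℝ, E) x).target) :
    MDifferentiableAt 𝓘(ℝ, E) 𝓘(ℝ, E) (extChartAt 𝓘(ℝ, E) x).symm y :=
  have : IsManifold 𝓘(ℝ, E) 1 M := IsManifold.of_le (n := ∞) (by simp)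
  (mdifferentiableWithinAt_extChartAt_symm (I := 𝓘(ℝ, E)) hy).mdifferentiableAt (by simp)

theorem chartSymmDeriv_injective (x : M) {y : E} (hy : y ∈ (extChartAt 𝓘(ℝ, E) x).target) :
    Function.Injective (chartSymmDeriv x y) := by
  have : IsManifold 𝓘(ℝ, E) 1 M := IsManifold.of_le (n := ∞) (by simp)
  have h := isInvertible_mfderivWithin_extChartAt_symm (I := 𝓘(ℝ, E)) hy
  rw [modelWithCornersSelf_coe, Set.range_id, mfderivWithin_univ] at h
  obtain ⟨e, he⟩ := h
  intro a b hab
  apply e.injective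
  have h2 : ∀ c, e c = chartSymmDeriv x y c := fun c ↦ congrArg (fun L ↦ L c) he
  exact (h2 a).trans (hab.trans (h2 b).symm)

/-- Coordinate fields are smooth: they are the tangent map of the inverse chart composed with a
constant section. -/
theorem contMDiffOn_chartSymmDeriv (x : M) (u : E) :
    ContMDiffOn 𝓘(ℝ, E) 𝓘(ℝ, E).tangent ∞ (fun y ↦
      (⟨(extChartAt 𝓘(ℝ, E) x).symm y, chartSymmDeriv x y u⟩ : TangentBundle 𝓘(ℝ, E) M))
      (extChartAt 𝓘(ℝ, E) x).target := by
  have : IsManifold 𝓘(ℝ, E) 1 M := IsManifold.of_le (n := ∞) (by simp)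
  have hopen : IsOpen (extChartAt 𝓘(ℝ, E) x).target := isOpen_extChartAt_target x
  have h1 := (contMDiffOn_extChartAt_symm (I := 𝓘(ℝ, E)) (n := ∞) x).contMDiffOn_tangentMapWithin
    (m := ∞) (by simp) hopen.uniqueMDiffOn
  have h2 : ContMDiff 𝓘(ℝ, E) 𝓘(ℝ, E).tangent ∞
      (fun y : E ↦ (⟨y, u⟩ : TangentBundle 𝓘(ℝ, E) E)) :=
    contMDiff_vectorSpace_iff_contDiff.2 contDiff_const
  have h3 := h1.comp h2.contMDiffOn (s := (extChartAt 𝓘(ℝ, E) x).target) (fun y hy ↦ hy)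
  refine h3.congr fun y hy ↦ ?_
  simp only [Function.comp_apply, tangentMapWithin, chartSymmDeriv]
  rw [mfderivWithin_of_isOpen hopen hy]
  rfl

variable [RiemannianBundle (fun x : M ↦ TangentSpace 𝓘(ℝ, E) x)]

theorem chartMetric_apply (x : M) (y u v : E) :
    chartMetric x y u v = inner ℝ (chartSymmDeriv x y u) (chartSymmDeriv x y v) := rfl

theorem chartMetric_self (x : M) (u v : TangentSpace 𝓘(ℝ, E) x) :
    chartMetric (E := E) x (extChartAt 𝓘(ℝ, E) x x) u v = inner ℝ u v := by
  have : IsManifold 𝓘(ℝ, E) 1 M := IsManifold.of_le (n := ∞) (by simp)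
  have h := mfderivWithin_range_extChartAt_symm (I := 𝓘(ℝ, E)) (x := x)
  rw [modelWithCornersSelf_coe, Set.range_id, mfderivWithin_univ] at h
  have h1 : ∀ w : E, chartSymmDeriv x (extChartAt 𝓘(ℝ, E) x x) w = w :=
    fun w ↦ congrArg (fun L ↦ L w) h
  -- The inverse chart returns to `x` only propositionally, so the inner products live on two
  -- formally different fibres and are compared by substitution.
  have key : ∀ p : M, p = x → ∀ u v : E,
      (inner ℝ (show TangentSpace 𝓘(ℝ, E) p from u) (show TangentSpace 𝓘(ℝ, E) p from v) : ℝ) =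
        inner ℝ (show TangentSpace 𝓘(ℝ, E) x from u) (show TangentSpace 𝓘(ℝ, E) x from v) := by
    rintro _ rfl _ _
    rfl
  exact (congrArg₂ (fun a b : TangentSpace 𝓘(ℝ, E) _ ↦ (inner ℝ a b : ℝ)) (h1 u) (h1 v)).trans
    (key _ (extChartAt_to_inv x) u v)

theorem isRiemannianOn_chartMetric
    [h : IsContMDiffRiemannianBundle 𝓘(ℝ, E) ∞ E (fun x : M ↦ TangentSpace 𝓘(ℝ, E) x)] (x : M) :
    IsRiemannianOn (chartMetric (E := E) x) (extChartAt 𝓘(ℝ, E) x).target where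
  isOpen := isOpen_extChartAt_target x
  contDiffOn := by
    -- In finite dimension smoothness can be checked on matrix entries, i.e. on the bundle metric
    -- evaluated at two coordinate fields.
    refine contDiffOn_clm_apply.2 fun u ↦ contDiffOn_clm_apply.2 fun v ↦ ?_
    obtain ⟨g, hg, hgi⟩ := h.exists_contMDiff
    intro y hy
    have h1 : ContMDiffWithinAt 𝓘(ℝ, E) (𝓘(ℝ, E).prod 𝓘(ℝ)) ∞
        (fun y ↦ TotalSpace.mk' ℝ (E := Bundle.Trivial M ℝ) ((extChartAt 𝓘(ℝ, E) x).symm y)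
          (g _ (chartSymmDeriv x y u) (chartSymmDeriv x y v)))
        (extChartAt 𝓘(ℝ, E) x).target y := by
      apply ContMDiffWithinAt.clm_bundle_apply₂ (F₁ := E) (F₂ := E)
      · exact hg.contMDiffAt.comp_contMDiffWithinAt y
          (contMDiffOn_extChartAt_symm (I := 𝓘(ℝ, E)) (n := ∞) x y hy)
      · exact contMDiffOn_chartSymmDeriv x u y hy
      · exact contMDiffOn_chartSymmDeriv x v y hy
    simp only [contMDiffWithinAt_totalSpace] at h1
    refine h1.2.contDiffWithinAt.congr_of_mem (fun z _ ↦ ?_) hy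
    exact hgi _ _ _
  symm y _ u v := by rw [chartMetric_apply, chartMetric_apply, real_inner_comm]
  pos y hy u hu := by
    rw [chartMetric_apply, real_inner_self_pos]
    intro h
    exact hu (chartSymmDeriv_injective x hy (h.trans (map_zero _).symm))

end ChartMetric

/-! ### Independence of orthonormal bases, and existence of the maxima. -/

section Frames

variable {T : Type*} [NormedAddCommGroup T] [InnerProductSpace ℝ T]

/-- `K u v` is a quadratic form in each of its arguments, and continuous. -/
structure IsBiquadratic (K : T → T → ℝ) : Prop where
  left : ∀ v, ∃ b : T →ₗ[ℝ] T →ₗ[ℝ] ℝ, ∀ u, K u v = b u u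
  right : ∀ u, ∃ b : T →ₗ[ℝ] T →ₗ[ℝ] ℝ, ∀ v, K u v = b v v
  continuous : Continuous fun p : T × T ↦ K p.1 p.2

/-- Expand `e'` in `e` and sum over `e'` first: Parseval gives ∑ₐ ⟨e_c, e'_a⟩⟨e'_a, e_d⟩ = δ_cd.
Symmetry of `b` plays no role. -/
theorem OrthonormalBasis.sum_bilin_eq {N : Type*} [AddCommGroup N] [Module ℝ N]
    {V : Submodule ℝ T} {ι ι' : Type*} [Fintype ι] [Fintype ι'] (e : OrthonormalBasis ι ℝ V)
    (e' : OrthonormalBasis ι' ℝ V) (b : T →ₗ[ℝ] T →ₗ[ℝ] N) :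
    ∑ a, b (e a) (e a) = ∑ a, b (e' a) (e' a) := by
  have h : ∀ a, ((e' a : V) : T) = ∑ c, (inner ℝ (e c) (e' a) : ℝ) • ((e c : V) : T) := by
    intro a
    conv_lhs => rw [← e.sum_repr' (e' a)]
    simp
  symm
  calc ∑ a, b (e' a) (e' a) = ∑ a, ∑ c, ∑ d,
        ((inner ℝ (e c) (e' a) : ℝ) * inner ℝ (e' a) (e d)) • b (e c) (e d) := by
        refine Finset.sum_congr rfl fun a _ ↦ ?_
        conv_lhs => rw [h a]
        simp only [map_sum, map_smul, LinearMap.sum_apply, LinearMap.smul_apply, smul_smul,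
          Finset.smul_sum]
        rw [Finset.sum_comm]
        refine Finset.sum_congr rfl fun c _ ↦ Finset.sum_congr rfl fun d _ ↦ ?_
        rw [real_inner_comm (e d), mul_comm]
    _ = ∑ c, ∑ d, (inner ℝ (e c) (e d) : ℝ) • b (e c) (e d) := by
        rw [Finset.sum_comm]
        refine Finset.sum_congr rfl fun c _ ↦ ?_
        rw [Finset.sum_comm]
        refine Finset.sum_congr rfl fun d _ ↦ ?_
        rw [← Finset.sum_smul, e'.sum_inner_mul_inner]
    _ = ∑ a, b (e a) (e a) := by
        refine Finset.sum_congr rfl fun c _ ↦ ?_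
        rw [Finset.sum_eq_single c]
        · simp
        · intro d _ hd
          rw [e.orthonormal.2 hd.symm, zero_smul]
        · simp

theorem Orthonormal.exists_orthonormalBasis {ι : Type*} [Fintype ι] {v : ι → T}
    (hv : Orthonormal ℝ v) {V : Submodule ℝ T} (hV : Submodule.span ℝ (Set.range v) = V) :
    ∃ b : OrthonormalBasis ι ℝ V, ∀ i, ((b i : V) : T) = v i := by
  subst hV
  let w : ι → Submodule.span ℝ (Set.range v) := fun i ↦ ⟨v i, Submodule.subset_span ⟨i, rfl⟩⟩
  have hw : Orthonormal ℝ w :=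
    ⟨fun i ↦ hv.1 i, fun i j hij ↦ hv.2 hij⟩
  have hs : ⊤ ≤ Submodule.span ℝ (Set.range w) := by
    rw [← Submodule.map_le_map_iff_of_injective (Submodule.injective_subtype _),
      Submodule.map_span, ← Set.range_comp, Submodule.map_top, Submodule.range_subtype]
    exact le_rfl
  exact ⟨OrthonormalBasis.mk hw hs, fun i ↦ by simp [w]⟩

/-- Frames stand in for Grassmannians: the orthonormality relations and membership in `W` are closed
conditions inside a unit ball. -/
theorem isCompact_orthonormal_frames [FiniteDimensional ℝ T] (ι : Type*) [Fintype ι]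
    (W : Submodule ℝ T) : IsCompact {e : ι → T | Orthonormal ℝ e ∧ ∀ p, e p ∈ W} := by
  classical
  have : ProperSpace T := FiniteDimensional.proper_real T
  have hsub : {e : ι → T | Orthonormal ℝ e ∧ ∀ p, e p ∈ W} ⊆ Metric.closedBall 0 1 := by
    rintro e ⟨he, -⟩
    rw [mem_closedBall_zero_iff, pi_norm_le_iff_of_nonneg zero_le_one]
    exact fun i ↦ (he.1 i).le
  refine (isCompact_closedBall _ _).of_isClosed_subset ?_ hsub
  have : {e : ι → T | Orthonormal ℝ e ∧ ∀ p, e p ∈ W} =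
      (⋂ i, ⋂ j, {e | inner ℝ (e i) (e j) = if i = j then (1 : ℝ) else 0}) ∩
      ⋂ p, (fun e : ι → T ↦ e p) ⁻¹' (W : Set T) := by
    ext e
    simp [orthonormal_iff_ite]
  rw [this]
  refine (isClosed_iInter fun i ↦ isClosed_iInter fun j ↦ isClosed_eq ?_ continuous_const).inter
    (isClosed_iInter fun p ↦ W.closed_of_finiteDimensional.preimage (continuous_apply p))
  fun_prop

theorem exists_orthonormal_frame [FiniteDimensional ℝ T] (ι : Type*) [Fintype ι]
    (W : Submodule ℝ T) (h : Fintype.card ι ≤ Module.finrank ℝ W) :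
    {e : ι → T | Orthonormal ℝ e ∧ ∀ p, e p ∈ W}.Nonempty := by
  let b := stdOrthonormalBasis ℝ W
  obtain ⟨g⟩ : Nonempty (ι ↪ Fin (Module.finrank ℝ W)) :=
    Function.Embedding.nonempty_of_card_le (by simpa using h)
  have h1 : Orthonormal ℝ (fun i ↦ b (g i)) := b.orthonormal.comp g g.injective
  exact ⟨fun i ↦ b (g i), ⟨fun i ↦ h1.1 i, fun i j hij ↦ h1.2 hij⟩, fun p ↦ (b (g p)).2⟩

variable {k : ℕ}

/-- The sum of `K (e_a, e_b)` over orthonormal bases of `V i` and `V j`, over all `i < j`. -/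
noncomputable def mutualSum [FiniteDimensional ℝ T] (K : T → T → ℝ)
    (V : Fin k → Submodule ℝ T) : ℝ :=
  ∑ i, ∑ j, if i < j then
    ∑ a, ∑ b, K (stdOrthonormalBasis ℝ (V i) a : T) (stdOrthonormalBasis ℝ (V j) b : T)
  else 0

/-- One basis is changed at a time, the other vector being held fixed. -/
theorem IsBiquadratic.mutualSum_eq [FiniteDimensional ℝ T] {K : T → T → ℝ} (hK : IsBiquadratic K)
    (V : Fin k → Submodule ℝ T) {ι : Fin k → Type*} [∀ i, Fintype (ι i)]
    (e : ∀ i, OrthonormalBasis (ι i) ℝ (V i)) :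
    mutualSum K V = ∑ i, ∑ j, if i < j then ∑ a, ∑ b, K (e i a) (e j b) else 0 := by
  refine Finset.sum_congr rfl fun i _ ↦ Finset.sum_congr rfl fun j _ ↦ ?_
  split_ifs
  · trans ∑ a, ∑ b, K (stdOrthonormalBasis ℝ (V i) a : T) (e j b)
    · refine Finset.sum_congr rfl fun a _ ↦ ?_
      obtain ⟨q, hq⟩ := hK.right (stdOrthonormalBasis ℝ (V i) a : T)
      simp only [hq]
      exact (stdOrthonormalBasis ℝ (V j)).sum_bilin_eq (e j) q
    · rw [Finset.sum_comm, Finset.sum_comm (t := Finset.univ (α := ι j))]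
      refine Finset.sum_congr rfl fun b _ ↦ ?_
      obtain ⟨q, hq⟩ := hK.left (e j b : T)
      simp only [hq]
      exact (stdOrthonormalBasis ℝ (V i)).sum_bilin_eq (e i) q
  · rfl

/-- Mutually orthogonal subspaces of `W` of prescribed dimensions. -/
def IsOrthogonalFamilyIn (W : Submodule ℝ T) (n : Fin k → ℕ) (V : Fin k → Submodule ℝ T) : Prop :=
  (∀ i, V i ≤ W) ∧ (∀ i, Module.finrank ℝ (V i) = n i) ∧
    ∀ i j, i ≠ j → ∀ u ∈ V i, ∀ v ∈ V j, inner ℝ u v = 0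

theorem IsOrthogonalFamilyIn.exists_frame [FiniteDimensional ℝ T] {W : Submodule ℝ T}
    {n : Fin k → ℕ} {V : Fin k → Submodule ℝ T} (hV : IsOrthogonalFamilyIn W n V) :
    ∃ e : ∀ i, OrthonormalBasis (Fin (n i)) ℝ (V i),
      Orthonormal ℝ (fun p : Σ i, Fin (n i) ↦ ((e p.1 p.2 : V p.1) : T)) := by
  refine ⟨fun i ↦ (stdOrthonormalBasis ℝ (V i)).reindex (finCongr (hV.2.1 i)), ?_⟩
  set e : ∀ i, OrthonormalBasis (Fin (n i)) ℝ (V i) :=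
    fun i ↦ (stdOrthonormalBasis ℝ (V i)).reindex (finCongr (hV.2.1 i))
  refine ⟨fun p ↦ (e p.1).orthonormal.1 p.2, ?_⟩
  rintro ⟨i, a⟩ ⟨j, b⟩ hp
  by_cases hij : i = j
  · subst hij
    exact (e i).orthonormal.2 (fun h ↦ hp (congrArg (Sigma.mk i) h))
  · exact hV.2.2 i j hij _ (e i a).2 _ (e j b).2

/-- The values form the continuous image of the compact set of orthonormal frames of total size ∑ nᵢ
in `W`, which is nonempty by the dimension bound. -/
theorem IsBiquadratic.isGreatest_mutualSum [FiniteDimensional ℝ T] {K : T → T → ℝ}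
    (hK : IsBiquadratic K) (W : Submodule ℝ T) (n : Fin k → ℕ)
    (hn : ∑ i, n i ≤ Module.finrank ℝ W) :
    IsGreatest {S | ∃ V, IsOrthogonalFamilyIn W n V ∧ S = mutualSum K V}
      (sSup {S | ∃ V, IsOrthogonalFamilyIn W n V ∧ S = mutualSum K V}) := by
  let Φ : ((Σ i, Fin (n i)) → T) → ℝ := fun e ↦
    ∑ i, ∑ j, if i < j then ∑ a, ∑ b, K (e ⟨i, a⟩) (e ⟨j, b⟩) else 0
  have hΦ : Continuous Φ := by
    refine continuous_finsetSum _ fun i _ ↦ continuous_finsetSum _ fun j _ ↦ ?_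
    split_ifs
    · refine continuous_finsetSum _ fun a _ ↦ continuous_finsetSum _ fun b _ ↦ ?_
      exact hK.continuous.comp (Continuous.prodMk
        (continuous_apply (⟨i, a⟩ : Σ i, Fin (n i))) (continuous_apply (⟨j, b⟩ : Σ i, Fin (n i))))
    · exact continuous_const
  have him : {S | ∃ V, IsOrthogonalFamilyIn W n V ∧ S = mutualSum K V} =
      Φ '' {e | Orthonormal ℝ e ∧ ∀ p, e p ∈ W} := by
    ext S
    constructor
    · rintro ⟨V, hV, rfl⟩
      obtain ⟨e, he⟩ := hV.exists_frame
      exact ⟨_, ⟨he, fun p ↦ hV.1 p.1 (e p.1 p.2).2⟩, (hK.mutualSum_eq V e).symm⟩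
    · rintro ⟨e, ⟨he, heW⟩, rfl⟩
      have hi : ∀ i, Orthonormal ℝ (fun a ↦ e ⟨i, a⟩) := fun i ↦
        he.comp (fun a ↦ (⟨i, a⟩ : Σ i, Fin (n i))) fun a b h ↦ by simpa using h
      choose b hb using fun i ↦ (hi i).exists_orthonormalBasis rfl
      refine ⟨fun i ↦ Submodule.span ℝ (Set.range fun a ↦ e ⟨i, a⟩), ⟨fun i ↦ ?_, fun i ↦ ?_, ?_⟩,
        ?_⟩
      · rw [Submodule.span_le]
        rintro _ ⟨a, rfl⟩
        exact heW _
      · rw [Module.finrank_eq_card_basis (b i).toBasis, Fintype.card_fin]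
      · intro i j hij
        have : Submodule.span ℝ (Set.range fun a ↦ e ⟨i, a⟩) ⟂
            Submodule.span ℝ (Set.range fun a ↦ e ⟨j, a⟩) := by
          rw [Submodule.isOrtho_span]
          rintro _ ⟨a, rfl⟩ _ ⟨c, rfl⟩
          exact he.2 (fun h ↦ hij (congrArg Sigma.fst h))
        exact fun u hu v hv ↦ this.inner_eq hu hv
      · rw [hK.mutualSum_eq _ b]
        simp only [hb, Φ]
  rw [him]
  refine ((isCompact_orthonormal_frames _ W).image hΦ).isGreatest_sSup
    ((exists_orthonormal_frame _ W ?_).image _)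
  simpa using hn

end Frames

/-! ### Traces of a vector-valued bilinear map on subspaces. -/

section MeanCurvature

variable {T : Type*} [NormedAddCommGroup T] [InnerProductSpace ℝ T] [FiniteDimensional ℝ T]
  {N : Type*} [NormedAddCommGroup N] [InnerProductSpace ℝ N]

/-- The trace of the bilinear map `h` on the subspace `V`. -/
noncomputable def traceOn (h : T →ₗ[ℝ] T →ₗ[ℝ] N) (V : Submodule ℝ T) : N :=
  ∑ a, h (stdOrthonormalBasis ℝ V a : T) (stdOrthonormalBasis ℝ V a : T)

theorem traceOn_eq (h : T →ₗ[ℝ] T →ₗ[ℝ] N) {V : Submodule ℝ T} {ι : Type*} [Fintype ι]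
    (e : OrthonormalBasis ι ℝ V) : traceOn h V = ∑ a, h (e a) (e a) :=
  (stdOrthonormalBasis ℝ V).sum_bilin_eq e h

/-- The same compactness argument, with frames of size `s`. -/
theorem isGreatest_norm_traceOn [FiniteDimensional ℝ N] (h : T →ₗ[ℝ] T →ₗ[ℝ] N)
    (W : Submodule ℝ T) {s : ℕ} (hs : s ≤ Module.finrank ℝ W) :
    IsGreatest {r | ∃ V : Submodule ℝ T, V ≤ W ∧ Module.finrank ℝ V = s ∧ r = ‖traceOn h V‖}
      (sSup {r | ∃ V : Submodule ℝ T, V ≤ W ∧ Module.finrank ℝ V = s ∧ r = ‖traceOn h V‖}) := by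
  let Φ : (Fin s → T) → ℝ := fun e ↦ ‖∑ a, h (e a) (e a)‖
  have hh : Continuous fun u ↦ h u u := by
    let g : T →ₗ[ℝ] T →L[ℝ] N := (LinearMap.toContinuousLinearMap (𝕜 := ℝ)).toLinearMap ∘ₗ h
    have hg : Continuous g := g.continuous_of_finiteDimensional
    exact hg.clm_apply continuous_id
  have hΦ : Continuous Φ :=
    (continuous_finsetSum _ fun a _ ↦ hh.comp (continuous_apply a)).norm
  have him : {r | ∃ V : Submodule ℝ T, V ≤ W ∧ Module.finrank ℝ V = s ∧ r = ‖traceOn h V‖} =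
      Φ '' {e | Orthonormal ℝ e ∧ ∀ p, e p ∈ W} := by
    ext r
    constructor
    · rintro ⟨V, hV, hd, rfl⟩
      let e := (stdOrthonormalBasis ℝ V).reindex (finCongr hd)
      exact ⟨fun a ↦ e a, ⟨⟨fun a ↦ e.orthonormal.1 a, fun a b hab ↦ e.orthonormal.2 hab⟩,
        fun a ↦ hV (e a).2⟩, by rw [traceOn_eq h e]⟩
    · rintro ⟨e, ⟨he, heW⟩, rfl⟩
      obtain ⟨b, hb⟩ := he.exists_orthonormalBasis rfl
      refine ⟨Submodule.span ℝ (Set.range e), ?_, ?_, ?_⟩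
      · rw [Submodule.span_le]
        rintro _ ⟨a, rfl⟩
        exact heW _
      · rw [Module.finrank_eq_card_basis b.toBasis, Fintype.card_fin]
      · rw [traceOn_eq h b]
        simp only [hb, Φ]
  rw [him]
  refine ((isCompact_orthonormal_frames _ W).image hΦ).isGreatest_sSup
    ((exists_orthonormal_frame _ W ?_).image _)
  simpa using hs

variable {k : ℕ} {W : Submodule ℝ T} {n : Fin k → ℕ} {V : Fin k → Submodule ℝ T}

/-- Concatenated bases of orthogonal subspaces form a basis of their sum; hence dimension and trace
are additive. -/
theorem IsOrthogonalFamilyIn.exists_basis_iSup (hV : IsOrthogonalFamilyIn W n V) :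
    ∃ (e : ∀ i, OrthonormalBasis (Fin (n i)) ℝ (V i))
      (b : OrthonormalBasis (Σ i, Fin (n i)) ℝ (⨆ i, V i : Submodule ℝ T)),
      ∀ p, ((b p : (⨆ i, V i : Submodule ℝ T)) : T) = e p.1 p.2 := by
  obtain ⟨e, he⟩ := hV.exists_frame
  refine ⟨e, he.exists_orthonormalBasis (le_antisymm ?_ (iSup_le fun i ↦ ?_))⟩
  · rw [Submodule.span_le]
    rintro _ ⟨p, rfl⟩
    exact Submodule.mem_iSup_of_mem p.1 (e p.1 p.2).2
  · intro u hu
    have h := congrArg (fun w : V i ↦ (w : T)) ((e i).sum_repr' ⟨u, hu⟩)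
    simp only [Submodule.coe_sum, Submodule.coe_smul] at h
    rw [← h]
    exact Submodule.sum_mem _ fun a _ ↦ Submodule.smul_mem _ _
      (Submodule.subset_span ⟨⟨i, a⟩, rfl⟩)

theorem IsOrthogonalFamilyIn.finrank_iSup (hV : IsOrthogonalFamilyIn W n V) :
    Module.finrank ℝ (⨆ i, V i : Submodule ℝ T) = ∑ i, n i := by
  obtain ⟨-, b, -⟩ := hV.exists_basis_iSup
  rw [Module.finrank_eq_card_basis b.toBasis]
  simp

theorem IsOrthogonalFamilyIn.traceOn_iSup (hV : IsOrthogonalFamilyIn W n V)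
    (h : T →ₗ[ℝ] T →ₗ[ℝ] N) : traceOn h (⨆ i, V i) = ∑ i, traceOn h (V i) := by
  obtain ⟨e, b, hb⟩ := hV.exists_basis_iSup
  rw [traceOn_eq h b, Fintype.sum_sigma]
  simp only [hb, traceOn_eq h (e _)]

end MeanCurvature

/-- Source of the constant: the left side is (‖H‖² - ∑ ‖H_i‖²)/2 with H = ∑ H_i, and ∑ ‖H_i‖² is
‖H‖²/k plus the deviation from the average, so ‖H‖² gets the coefficient (1 - 1/k)/2. -/
theorem sum_sum_lt_inner_eq {N : Type*} [NormedAddCommGroup N] [InnerProductSpace ℝ N] {k : ℕ}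
    (hk : 0 < k) (H : Fin k → N) :
    (∑ i, ∑ j, if i < j then (inner ℝ (H i) (H j) : ℝ) else 0) =
      ((k : ℝ) - 1) / (2 * k) * ‖∑ i, H i‖ ^ 2 -
        (1 / 2) * ∑ i, ‖H i - (1 / k : ℝ) • ∑ j, H j‖ ^ 2 := by
  have hk' : (k : ℝ) ≠ 0 := by positivity
  have h1 : ‖∑ i, H i‖ ^ 2 = ∑ i, ‖H i‖ ^ 2 +
      2 * ∑ i, ∑ j, if i < j then (inner ℝ (H i) (H j) : ℝ) else 0 := by
    have h2 : ∀ i j : Fin k, (inner ℝ (H i) (H j) : ℝ) = (if i = j then ‖H i‖ ^ 2 else 0) +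
        (if i < j then (inner ℝ (H i) (H j) : ℝ) else 0) +
        (if j < i then (inner ℝ (H j) (H i) : ℝ) else 0) := by
      intro i j
      rcases lt_trichotomy i j with h | rfl | h
      · simp [h, h.ne, h.not_gt]
      · simp
      · simp [h, h.ne', h.not_gt, real_inner_comm]
    rw [← real_inner_self_eq_norm_sq, sum_inner]
    simp_rw [inner_sum]
    rw [Finset.sum_congr rfl fun i _ ↦ Finset.sum_congr rfl fun j _ ↦ h2 i j]
    simp only [Finset.sum_add_distrib, Finset.sum_ite_eq, Finset.mem_univ, if_true]
    rw [Finset.sum_comm (f := fun i j ↦ if j < i then (inner ℝ (H j) (H i) : ℝ) else 0)]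
    ring
  have h3 : ∑ i, ‖H i - (1 / k : ℝ) • ∑ j, H j‖ ^ 2 =
      ∑ i, ‖H i‖ ^ 2 - (1 / k) * ‖∑ i, H i‖ ^ 2 := by
    simp only [norm_sub_sq_real, inner_smul_right, Finset.sum_add_distrib, Finset.sum_sub_distrib,
      ← Finset.mul_sum, ← sum_inner, norm_smul, real_inner_self_eq_norm_sq]
    simp
    field_simp
    ring
  rw [h3, eq_sub_of_add_eq' h1.symm |> fun h ↦ (eq_div_of_mul_eq two_ne_zero ((mul_comm _ _).trans h))]
  field_simp
  ring

/-! ### From the Gauss equation to the inequality, in linear algebra. -/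

section GaussEquation

variable {T : Type*} [NormedAddCommGroup T] [InnerProductSpace ℝ T] [FiniteDimensional ℝ T]
  {N : Type*} [NormedAddCommGroup N] [InnerProductSpace ℝ N] [FiniteDimensional ℝ N]
  {k : ℕ} {W : Submodule ℝ T} {n : Fin k → ℕ} {V : Fin k → Submodule ℝ T}
  {φ : T →ₗ[ℝ] N} {K : T → T → ℝ} {K' : N → N → ℝ} {h : T →ₗ[ℝ] T →ₗ[ℝ] N}

theorem exists_orthonormalBasis_map (hφ : ∀ u v, (inner ℝ (φ u) (φ v) : ℝ) = inner ℝ u v)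
    {ι : Type*} [Fintype ι] {U : Submodule ℝ T} (e : OrthonormalBasis ι ℝ U) :
    ∃ b : OrthonormalBasis ι ℝ (U.map φ), ∀ i, ((b i : U.map φ) : N) = φ (e i) := by
  classical
  refine Orthonormal.exists_orthonormalBasis ?_ ?_
  · rw [orthonormal_iff_ite]
    intro i j
    rw [hφ]
    exact orthonormal_iff_ite.1 e.orthonormal i j
  · have h1 : Submodule.span ℝ (Set.range fun i ↦ ((e i : U) : T)) = U := by
      have h2 := congrArg (Submodule.map U.subtype) e.toBasis.span_eq
      rwa [Submodule.map_span, ← Set.range_comp, Submodule.map_top, Submodule.range_subtype,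
        e.coe_toBasis] at h2
    conv_rhs => rw [← h1, Submodule.map_span, ← Set.range_comp]
    rfl

theorem IsOrthogonalFamilyIn.map (hφ : ∀ u v, (inner ℝ (φ u) (φ v) : ℝ) = inner ℝ u v)
    {W' : Submodule ℝ N} (hW : ∀ u ∈ W, φ u ∈ W') (hV : IsOrthogonalFamilyIn W n V) :
    IsOrthogonalFamilyIn W' n fun i ↦ (V i).map φ := by
  refine ⟨fun i ↦ ?_, fun i ↦ ?_, fun i j hij ↦ ?_⟩
  · rintro _ ⟨u, hu, rfl⟩
    exact hW u (hV.1 i hu)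
  · obtain ⟨b, -⟩ := exists_orthonormalBasis_map hφ (stdOrthonormalBasis ℝ (V i))
    rw [Module.finrank_eq_card_basis b.toBasis, Fintype.card_fin, hV.2.1]
  · rintro _ ⟨u, hu, rfl⟩ _ ⟨v, hv, rfl⟩
    rw [hφ]
    exact hV.2.2 i j hij u hu v hv

/-- The squared norm of the mixed components of `h`, in given orthonormal bases. -/
noncomputable def mixedNormSq (h : T →ₗ[ℝ] T →ₗ[ℝ] N) (V : Fin k → Submodule ℝ T)
    (e : ∀ i, OrthonormalBasis (Fin (n i)) ℝ (V i)) : ℝ :=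
  ∑ i, ∑ j, if i < j then ∑ a, ∑ b, ‖h (e i a) (e j b)‖ ^ 2 else 0

theorem mixedNormSq_nonneg (e : ∀ i, OrthonormalBasis (Fin (n i)) ℝ (V i)) :
    0 ≤ mixedNormSq h V e := by
  refine Finset.sum_nonneg fun i _ ↦ Finset.sum_nonneg fun j _ ↦ ?_
  split_ifs <;> positivity

/-- Only pairs i < j are counted, so symmetry of `h` supplies the pairs with i > j; bilinearity
passes from basis vectors to the subspaces. -/
theorem mixedNormSq_eq_zero_iff (hsymm : ∀ u v, h u v = h v u)
    (e : ∀ i, OrthonormalBasis (Fin (n i)) ℝ (V i)) :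
    mixedNormSq h V e = 0 ↔ ∀ i j, i ≠ j → ∀ u ∈ V i, ∀ v ∈ V j, h u v = 0 := by
  constructor
  · intro h0
    have h1 : ∀ i j, i < j → ∀ u ∈ V i, ∀ v ∈ V j, h u v = 0 := by
      intro i j hij u hu v hv
      have h2 : ∀ i j, 0 ≤ if i < j then ∑ a, ∑ b, ‖h (e i a) (e j b)‖ ^ 2 else 0 := by
        intro i j
        split_ifs <;> positivity
      rw [mixedNormSq, Finset.sum_eq_zero_iff_of_nonneg
        fun i _ ↦ Finset.sum_nonneg fun j _ ↦ h2 i j] at h0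
      have h3 := h0 i (Finset.mem_univ _)
      rw [Finset.sum_eq_zero_iff_of_nonneg fun j _ ↦ h2 i j] at h3
      have h4 := h3 j (Finset.mem_univ _)
      rw [if_pos hij, Finset.sum_eq_zero_iff_of_nonneg (fun _ _ ↦ by positivity)] at h4
      have h5 : ∀ a b, h (e i a) (e j b) = 0 := by
        intro a b
        have h6 := h4 a (Finset.mem_univ _)
        rw [Finset.sum_eq_zero_iff_of_nonneg (fun _ _ ↦ by positivity)] at h6
        simpa using h6 b (Finset.mem_univ _)
      have hu' := congrArg (fun w : V i ↦ (w : T)) ((e i).sum_repr' ⟨u, hu⟩)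
      have hv' := congrArg (fun w : V j ↦ (w : T)) ((e j).sum_repr' ⟨v, hv⟩)
      simp only [Submodule.coe_sum, Submodule.coe_smul] at hu' hv'
      rw [← hu', ← hv']
      simp [h5]
    intro i j hij u hu v hv
    rcases lt_or_gt_of_ne hij with hlt | hlt
    · exact h1 i j hlt u hu v hv
    · rw [hsymm]
      exact h1 j i hlt v hv u hu
  · intro h0
    refine Finset.sum_eq_zero fun i _ ↦ Finset.sum_eq_zero fun j _ ↦ ?_
    split_ifs with hij
    · refine Finset.sum_eq_zero fun a _ ↦ Finset.sum_eq_zero fun b _ ↦ ?_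
      rw [h0 i j hij.ne _ (e i a).2 _ (e j b).2]
      simp
    · rfl

/-- Summing ⟨h(e_a,e_a), h(e_b,e_b)⟩ over bases of V_i and V_j gives the inner product of the two
traces. What remains are two nonnegative defects, which measure unequal traces and mixed components.
-/
theorem mutualSum_eq_of_gauss (hk : 0 < k) (hK : IsBiquadratic K) (hK' : IsBiquadratic K')
    (hφ : ∀ u v, (inner ℝ (φ u) (φ v) : ℝ) = inner ℝ u v)
    (hgauss : ∀ u v, K u v = K' (φ u) (φ v) + inner ℝ (h u u) (h v v) - ‖h u v‖ ^ 2)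
    (hV : IsOrthogonalFamilyIn W n V) (e : ∀ i, OrthonormalBasis (Fin (n i)) ℝ (V i)) :
    mutualSum K V = mutualSum K' (fun i ↦ (V i).map φ) +
      ((k : ℝ) - 1) / (2 * k) * ‖traceOn h (⨆ i, V i)‖ ^ 2 -
      (1 / 2) * ∑ i, ‖traceOn h (V i) - (1 / k : ℝ) • ∑ j, traceOn h (V j)‖ ^ 2 -
      mixedNormSq h V e := by
  choose b hb using fun i ↦ exists_orthonormalBasis_map hφ (e i)
  rw [hK.mutualSum_eq V e, hK'.mutualSum_eq _ b, hV.traceOn_iSup, add_sub_assoc _ (_ * _),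
    ← sum_sum_lt_inner_eq hk, mixedNormSq, ← Finset.sum_add_distrib, ← Finset.sum_sub_distrib]
  refine Finset.sum_congr rfl fun i _ ↦ ?_
  rw [← Finset.sum_add_distrib, ← Finset.sum_sub_distrib]
  refine Finset.sum_congr rfl fun j _ ↦ ?_
  split_ifs
  · simp only [hgauss, hb, Finset.sum_add_distrib, Finset.sum_sub_distrib, ← inner_sum, ← sum_inner,
      traceOn_eq h (e _)]
  · simp

theorem sum_norm_sub_average_sq_eq_zero_iff {k : ℕ} (hk : 0 < k) (H : Fin k → N) :
    ∑ i, ‖H i - (1 / k : ℝ) • ∑ j, H j‖ ^ 2 = 0 ↔ ∀ i j, H i = H j := by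
  rw [Finset.sum_eq_zero_iff_of_nonneg fun _ _ ↦ by positivity]
  simp only [Finset.mem_univ, forall_const, ne_eq, OfNat.ofNat_ne_zero, not_false_eq_true,
    pow_eq_zero_iff, norm_eq_zero, sub_eq_zero]
  constructor
  · intro h0 i j
    rw [h0 i, ← h0 j]
  · intro h0 i
    have hk' : (k : ℝ) ≠ 0 := by positivity
    rw [Finset.sum_congr rfl fun j _ ↦ h0 j i]
    simp [← Nat.cast_smul_eq_nsmul ℝ, smul_smul, hk']

/-- The inequality and its equality case, from the Gauss equation. -/
theorem sSup_mutualSum_le_of_gauss (hk : 2 ≤ k) (hK : IsBiquadratic K) (hK' : IsBiquadratic K')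
    (hφ : ∀ u v, (inner ℝ (φ u) (φ v) : ℝ) = inner ℝ u v) (hsymm : ∀ u v, h u v = h v u)
    (hgauss : ∀ u v, K u v = K' (φ u) (φ v) + inner ℝ (h u u) (h v v) - ‖h u v‖ ^ 2)
    {W' : Submodule ℝ N} (hW : ∀ u ∈ W, φ u ∈ W') {δ δ' m : ℝ}
    (hδ : IsGreatest {S | ∃ V, IsOrthogonalFamilyIn W n V ∧ S = mutualSum K V} δ)
    (hδ' : IsGreatest {S | ∃ V, IsOrthogonalFamilyIn W' n V ∧ S = mutualSum K' V} δ')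
    (hm : IsGreatest {r | ∃ V : Submodule ℝ T, V ≤ W ∧ Module.finrank ℝ V = ∑ i, n i ∧
      r = ‖traceOn h V‖} m) :
    δ ≤ δ' + ((k : ℝ) - 1) / (2 * k) * m ^ 2 ∧
    (δ = δ' + ((k : ℝ) - 1) / (2 * k) * m ^ 2 ↔
      ∃ V, IsOrthogonalFamilyIn W n V ∧
        (∀ i j, i ≠ j → ∀ u ∈ V i, ∀ v ∈ V j, h u v = 0) ∧
        (∀ i j, traceOn h (V i) = traceOn h (V j)) ∧
        ‖traceOn h (⨆ i, V i)‖ = m ∧ mutualSum K' (fun i ↦ (V i).map φ) = δ') := by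
  have hk0 : 0 < k := by omega
  -- Strict positivity, from k ≥ 2, is what lets equality force ‖H_V‖ = m.
  have hc : 0 < ((k : ℝ) - 1) / (2 * k) := by
    have : (2 : ℝ) ≤ k := by exact_mod_cast hk
    exact div_pos (by linarith) (by linarith)
  have hmap : ∀ V, IsOrthogonalFamilyIn W n V → mutualSum K' (fun i ↦ (V i).map φ) ≤ δ' :=
    fun V hV ↦ hδ'.2 ⟨_, hV.map hφ hW, rfl⟩
  have hnorm : ∀ V, IsOrthogonalFamilyIn W n V → ‖traceOn h (⨆ i, V i)‖ ≤ m :=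
    fun V hV ↦ hm.2 ⟨_, iSup_le hV.1, hV.finrank_iSup, rfl⟩
  -- A maximiser for δ proves the inequality and is also the witness in the equality case.
  obtain ⟨V, hV, hVδ⟩ := hδ.1
  obtain ⟨e, -⟩ := hV.exists_frame
  have heq := mutualSum_eq_of_gauss hk0 hK hK' hφ hgauss hV e
  have h1 := hmap V hV
  have h2 : ((k : ℝ) - 1) / (2 * k) * ‖traceOn h (⨆ i, V i)‖ ^ 2 ≤
      ((k : ℝ) - 1) / (2 * k) * m ^ 2 :=
    mul_le_mul_of_nonneg_left (pow_le_pow_left₀ (norm_nonneg _) (hnorm V hV) 2) hc.le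
  have h3 : 0 ≤ ∑ i, ‖traceOn h (V i) - (1 / k : ℝ) • ∑ j, traceOn h (V j)‖ ^ 2 :=
    Finset.sum_nonneg fun _ _ ↦ by positivity
  have h4 := mixedNormSq_nonneg (h := h) e
  have hle : δ ≤ δ' + ((k : ℝ) - 1) / (2 * k) * m ^ 2 := by linarith
  refine ⟨hle, fun hE ↦ ?_, ?_⟩
  -- At equality the four nonnegative slacks `h1`–`h4` sum to zero, so each vanishes.
  · refine ⟨V, hV, ?_, ?_, ?_, ?_⟩
    · exact (mixedNormSq_eq_zero_iff hsymm e).1 (by linarith)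
    · exact (sum_norm_sub_average_sq_eq_zero_iff hk0 _).1 (by linarith)
    · have h5 : ‖traceOn h (⨆ i, V i)‖ ^ 2 = m ^ 2 := mul_left_cancel₀ hc.ne' (by linarith)
      exact (pow_left_inj₀ (norm_nonneg _) ((norm_nonneg _).trans (hnorm V hV)) two_ne_zero).1 h5
    · linarith
  · rintro ⟨V, hV, hmix, hH, hmax, hS⟩
    obtain ⟨e, -⟩ := hV.exists_frame
    -- Under the four conditions the identity says that this V realises the bound, and δ dominates
    -- its mutual curvature.
    refine le_antisymm hle ?_
    have h6 := mutualSum_eq_of_gauss hk0 hK hK' hφ hgauss hV e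
    rw [(mixedNormSq_eq_zero_iff hsymm e).2 hmix, (sum_norm_sub_average_sq_eq_zero_iff hk0 _).2 hH, hmax, hS,
      mul_zero, sub_zero, sub_zero] at h6
    rw [← h6]
    exact hδ.2 ⟨V, hV, rfl⟩

end GaussEquation

/-! ### Sectional curvature and distributions at a point of a manifold. -/

section SectionalCurvature

variable {E : Type*} [NormedAddCommGroup E] [NormedSpace ℝ E] [FiniteDimensional ℝ E]
  {M : Type*} [TopologicalSpace M] [ChartedSpace E M] [IsManifold 𝓘(ℝ, E) ∞ M]
  [RiemannianBundle (fun x : M ↦ TangentSpace 𝓘(ℝ, E) x)]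

theorem sectionalCurvature_eq_chart (x : M) (u v : TangentSpace 𝓘(ℝ, E) x) :
    sectionalCurvature x u v = chartMetric (E := E) x (extChartAt 𝓘(ℝ, E) x x)
      (chartCurvature (chartMetric (E := E) x) (extChartAt 𝓘(ℝ, E) x x) u v v) u :=
  (chartMetric_self x _ _).symm

theorem isBiquadratic_sectionalCurvature
    [IsContMDiffRiemannianBundle 𝓘(ℝ, E) ∞ E (fun x : M ↦ TangentSpace 𝓘(ℝ, E) x)] (x : M) :
    IsBiquadratic (sectionalCurvature (E := E) x) where
  left v := by
    obtain ⟨b, hb⟩ := (isRiemannianOn_chartMetric (E := E) x).exists_bilin_chartCurvature_left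
      (mem_extChartAt_target x) v
    exact ⟨b, fun u ↦ (sectionalCurvature_eq_chart x u v).trans (hb u)⟩
  right u := by
    obtain ⟨b, hb⟩ := (isRiemannianOn_chartMetric (E := E) x).exists_bilin_chartCurvature_right
      (mem_extChartAt_target x) u
    exact ⟨b, fun v ↦ (sectionalCurvature_eq_chart x u v).trans (hb v)⟩
  continuous := by
    have h := (isRiemannianOn_chartMetric (E := E) x).continuous_chartCurvature
      (mem_extChartAt_target x)
    exact h.congr fun p ↦ (sectionalCurvature_eq_chart x p.1 p.2).symm

theorem SmoothDistribution.finrank_fiber {d : ℕ} (D : SmoothDistribution E M d) (x : M) :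
    Module.finrank ℝ (D.fiber x) = d := by
  obtain ⟨U, -, hx, X, -, h⟩ := D.exists_localFrame x
  rw [← (h x hx).2, finrank_span_eq_card (h x hx).1, Fintype.card_fin]

end SectionalCurvature

/-! ### Isometric immersions: second fundamental form and Gauss equation. -/

section Immersion

variable {E : Type*} [NormedAddCommGroup E] [NormedSpace ℝ E] [FiniteDimensional ℝ E]
  {M : Type*} [TopologicalSpace M] [ChartedSpace E M] [IsManifold 𝓘(ℝ, E) ∞ M]
  [RiemannianBundle (fun x : M ↦ TangentSpace 𝓘(ℝ, E) x)]
  {E' : Type*} [NormedAddCommGroup E'] [NormedSpace ℝ E'] [FiniteDimensional ℝ E']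
  {M' : Type*} [TopologicalSpace M'] [ChartedSpace E' M'] [IsManifold 𝓘(ℝ, E') ∞ M']
  [RiemannianBundle (fun x : M' ↦ TangentSpace 𝓘(ℝ, E') x)]

/-- The part of the target of the chart at `x` where `f` can be read in the chart at `f x`. -/
def chartDomain (f : M → M') (x : M) : Set E :=
  (extChartAt 𝓘(ℝ, E) x).target ∩
    (extChartAt 𝓘(ℝ, E) x).symm ⁻¹' (f ⁻¹' (extChartAt 𝓘(ℝ, E') (f x)).source)

theorem isOpen_chartDomain {f : M → M'} (hf : Continuous f) (x : M) :
    IsOpen (chartDomain (E := E) (E' := E') f x) :=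
  (continuousOn_extChartAt_symm x).isOpen_inter_preimage (isOpen_extChartAt_target x)
    ((isOpen_extChartAt_source (f x)).preimage hf)

theorem mem_chartDomain (f : M → M') (x : M) :
    extChartAt 𝓘(ℝ, E) x x ∈ chartDomain (E := E) (E' := E') f x :=
  ⟨mem_extChartAt_target x, by simp⟩

theorem contDiffAt_writtenInExtChartAt {f : M → M'} (hf : ContMDiff 𝓘(ℝ, E) 𝓘(ℝ, E') ∞ f) (x : M)
    {z : E} (hz : z ∈ chartDomain (E := E) (E' := E') f x) :
    ContDiffAt ℝ ∞ (writtenInExtChartAt 𝓘(ℝ, E) 𝓘(ℝ, E') x f) z := by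
  have h1 : ContMDiffAt 𝓘(ℝ, E) 𝓘(ℝ, E) ∞ (extChartAt 𝓘(ℝ, E) x).symm z :=
    (contMDiffOn_extChartAt_symm (I := 𝓘(ℝ, E)) (n := ∞) x).contMDiffAt
      ((isOpen_extChartAt_target x).mem_nhds hz.1)
  have h2 : ContMDiffAt 𝓘(ℝ, E') 𝓘(ℝ, E') ∞ (extChartAt 𝓘(ℝ, E') (f x))
      (f ((extChartAt 𝓘(ℝ, E) x).symm z)) :=
    contMDiffAt_extChartAt' (by simpa using hz.2)
  exact (h2.comp z (hf.contMDiffAt.comp z h1)).contDiffAt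

theorem mapsTo_writtenInExtChartAt (f : M → M') (x : M) :
    Set.MapsTo (writtenInExtChartAt 𝓘(ℝ, E) 𝓘(ℝ, E') x f) (chartDomain (E := E) (E' := E') f x)
      (extChartAt 𝓘(ℝ, E') (f x)).target :=
  fun _ hz ↦ (extChartAt 𝓘(ℝ, E') (f x)).map_source hz.2

/-- Differentiate ψ⁻¹ ∘ F = f ∘ φ⁻¹ near `z`, with φ, ψ the charts. The equation is stated in `E'`
because the two base points agree only propositionally. -/
theorem chartSymmDeriv_fderiv_writtenInExtChartAt {f : M → M'}
    (hf : ContMDiff 𝓘(ℝ, E) 𝓘(ℝ, E') ∞ f) (x : M) {z : E}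
    (hz : z ∈ chartDomain (E := E) (E' := E') f x) (a : E) :
    (chartSymmDeriv (f x) (writtenInExtChartAt 𝓘(ℝ, E) 𝓘(ℝ, E') x f z)
      (fderiv ℝ (writtenInExtChartAt 𝓘(ℝ, E) 𝓘(ℝ, E') x f) z a) : E') =
    mfderiv 𝓘(ℝ, E) 𝓘(ℝ, E') f ((extChartAt 𝓘(ℝ, E) x).symm z) (chartSymmDeriv x z a) := by
  have h1 : ((extChartAt 𝓘(ℝ, E') (f x)).symm ∘ writtenInExtChartAt 𝓘(ℝ, E) 𝓘(ℝ, E') x f)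
      =ᶠ[nhds z] f ∘ (extChartAt 𝓘(ℝ, E) x).symm := by
    filter_upwards [(isOpen_chartDomain (E := E) (E' := E') hf.continuous x).mem_nhds hz] with w hw
    exact (extChartAt 𝓘(ℝ, E') (f x)).left_inv hw.2
  have h2 := h1.mfderiv_eq (I := 𝓘(ℝ, E)) (I' := 𝓘(ℝ, E'))
  have h3 : MDifferentiableAt 𝓘(ℝ, E) 𝓘(ℝ, E') (writtenInExtChartAt 𝓘(ℝ, E) 𝓘(ℝ, E') x f) z :=
    ((contDiffAt_writtenInExtChartAt hf x hz).differentiableAt (by simp)).mdifferentiableAt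
  rw [mfderiv_comp z (mdifferentiableAt_extChartAt_symm (f x) (mapsTo_writtenInExtChartAt f x hz))
    h3, mfderiv_comp z (hf.mdifferentiableAt (by simp))
    (mdifferentiableAt_extChartAt_symm x hz.1), mfderiv_eq_fderiv] at h2
  exact congrArg (fun L ↦ L a) h2

theorem inner_tangentSpace_congr {p q : M} (h : p = q) (u v : E) :
    (inner ℝ (show TangentSpace 𝓘(ℝ, E) p from u) (show TangentSpace 𝓘(ℝ, E) p from v) : ℝ) =
      inner ℝ (show TangentSpace 𝓘(ℝ, E) q from u) (show TangentSpace 𝓘(ℝ, E) q from v) := by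
  subst h
  rfl

theorem chartMetric_fderiv_writtenInExtChartAt {f : M → M'}
    (hf : IsIsometricImmersion (E := E) (E' := E') f) (x : M) {z : E}
    (hz : z ∈ chartDomain (E := E) (E' := E') f x) (a b : E) :
    chartMetric (E := E') (f x) (writtenInExtChartAt 𝓘(ℝ, E) 𝓘(ℝ, E') x f z)
      (fderiv ℝ (writtenInExtChartAt 𝓘(ℝ, E) 𝓘(ℝ, E') x f) z a)
      (fderiv ℝ (writtenInExtChartAt 𝓘(ℝ, E) 𝓘(ℝ, E') x f) z b) = chartMetric (E := E) x z a b := by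
  have hp : (extChartAt 𝓘(ℝ, E') (f x)).symm (writtenInExtChartAt 𝓘(ℝ, E) 𝓘(ℝ, E') x f z) =
      f ((extChartAt 𝓘(ℝ, E) x).symm z) := (extChartAt 𝓘(ℝ, E') (f x)).left_inv hz.2
  have h := chartSymmDeriv_fderiv_writtenInExtChartAt hf.1 x hz
  rw [chartMetric_apply, chartMetric_apply, ← hf.2]
  refine (inner_tangentSpace_congr (E := E') (M := M') hp _ _).trans ?_
  exact congrArg₂ (fun a b : TangentSpace 𝓘(ℝ, E') _ ↦ (inner ℝ a b : ℝ)) (h a) (h b)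

theorem mfderiv_eq_fderiv_writtenInExtChartAt {f : M → M'}
    (hf : ContMDiff 𝓘(ℝ, E) 𝓘(ℝ, E') ∞ f) (x : M) :
    mfderiv 𝓘(ℝ, E) 𝓘(ℝ, E') f x = fderiv ℝ (writtenInExtChartAt 𝓘(ℝ, E) 𝓘(ℝ, E') x f)
      (extChartAt 𝓘(ℝ, E) x x) := by
  refine (hf.mdifferentiableAt (by simp)).mfderiv.trans ?_
  rw [modelWithCornersSelf_coe, Set.range_id, fderivWithin_univ]

theorem ambientDeriv_eq (f : M → M') (x : M) (u v : TangentSpace 𝓘(ℝ, E) x) :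
    ambientDeriv (E' := E') f x u v = covDerivAlong (chartMetric (E := E') (f x))
      (writtenInExtChartAt 𝓘(ℝ, E) 𝓘(ℝ, E') x f)
      (fun z ↦ fderiv ℝ (writtenInExtChartAt 𝓘(ℝ, E) 𝓘(ℝ, E') x f) z v) u
      (extChartAt 𝓘(ℝ, E) x x) := by
  -- Proved over plain vector spaces, then transferred by unfolding the tangent spaces.
  have h : ∀ (F : E → E') (G' : E' → E' →L[ℝ] E' →L[ℝ] ℝ) (y u v : E),
      fderiv ℝ (fun z ↦ fderiv ℝ F z v) y u +
        christoffel G' (F y) (fderiv ℝ F y u) (fderiv ℝ F y v) =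
      covDerivAlong G' F (fun z ↦ fderiv ℝ F z v) u y := by
    intro F G' y u v
    rw [covDerivAlong, christoffelL_apply]
  exact h _ _ _ _ _

theorem writtenInExtChartAt_self (f : M → M') (x : M) :
    writtenInExtChartAt 𝓘(ℝ, E) 𝓘(ℝ, E') x f (extChartAt 𝓘(ℝ, E) x x) =
      extChartAt 𝓘(ℝ, E') (f x) (f x) := by
  simp [writtenInExtChartAt]

/-- The tangential part of the ambient derivative is the intrinsic one; this is what `normalPart`
removes. -/
theorem inner_mfderiv_ambientDeriv
    [IsContMDiffRiemannianBundle 𝓘(ℝ, E) ∞ E (fun x : M ↦ TangentSpace 𝓘(ℝ, E) x)]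
    [IsContMDiffRiemannianBundle 𝓘(ℝ, E') ∞ E' (fun x : M' ↦ TangentSpace 𝓘(ℝ, E') x)]
    {f : M → M'} (hf : IsIsometricImmersion (E := E) (E' := E') f) (x : M)
    (u v w : TangentSpace 𝓘(ℝ, E) x) :
    (inner ℝ (mfderiv 𝓘(ℝ, E) 𝓘(ℝ, E') f x w) (ambientDeriv (E' := E') f x u v) : ℝ) =
      chartMetric (E := E) x (extChartAt 𝓘(ℝ, E) x x)
        (christoffelL (chartMetric (E := E) x) (extChartAt 𝓘(ℝ, E) x x) u v) w := by
  have hU := isOpen_chartDomain (E := E) (E' := E') hf.1.continuous x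
  have h := apply_covDerivAlong_fderiv
    ((isRiemannianOn_chartMetric (E := E) x).mono hU fun _ h ↦ h.1)
    (isRiemannianOn_chartMetric (E := E') (f x))
    (fun z hz ↦ contDiffAt_writtenInExtChartAt hf.1 x hz) (mapsTo_writtenInExtChartAt f x)
    (fun z hz ↦ chartMetric_fderiv_writtenInExtChartAt hf x hz) (mem_chartDomain f x) u v w
  rw [← h, real_inner_comm, ambientDeriv_eq, mfderiv_eq_fderiv_writtenInExtChartAt hf.1,
    writtenInExtChartAt_self]
  exact (chartMetric_self _ _ _).symm

/-- The Gauss equation before normal parts are taken. -/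
theorem sectionalCurvature_eq_ambient
    [IsContMDiffRiemannianBundle 𝓘(ℝ, E) ∞ E (fun x : M ↦ TangentSpace 𝓘(ℝ, E) x)]
    [IsContMDiffRiemannianBundle 𝓘(ℝ, E') ∞ E' (fun x : M' ↦ TangentSpace 𝓘(ℝ, E') x)]
    {f : M → M'} (hf : IsIsometricImmersion (E := E) (E' := E') f) (x : M)
    (u v : TangentSpace 𝓘(ℝ, E) x) :
    sectionalCurvature x u v = sectionalCurvature (f x) (mfderiv 𝓘(ℝ, E) 𝓘(ℝ, E') f x u)
        (mfderiv 𝓘(ℝ, E) 𝓘(ℝ, E') f x v) +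
      (inner ℝ (ambientDeriv (E' := E') f x v v) (ambientDeriv (E' := E') f x u u) -
        chartMetric (E := E) x (extChartAt 𝓘(ℝ, E) x x)
          (christoffelL (chartMetric (E := E) x) (extChartAt 𝓘(ℝ, E) x x) v v)
          (christoffelL (chartMetric (E := E) x) (extChartAt 𝓘(ℝ, E) x x) u u)) -
      (inner ℝ (ambientDeriv (E' := E') f x u v) (ambientDeriv (E' := E') f x u v) -
        chartMetric (E := E) x (extChartAt 𝓘(ℝ, E) x x)
          (christoffelL (chartMetric (E := E) x) (extChartAt 𝓘(ℝ, E) x x) u v)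
          (christoffelL (chartMetric (E := E) x) (extChartAt 𝓘(ℝ, E) x x) u v)) := by
  have hU := isOpen_chartDomain (E := E) (E' := E') hf.1.continuous x
  have h := gauss_equation_chart
    ((isRiemannianOn_chartMetric (E := E) x).mono hU fun _ h ↦ h.1)
    (isRiemannianOn_chartMetric (E := E') (f x))
    (fun z hz ↦ contDiffAt_writtenInExtChartAt hf.1 x hz) (mapsTo_writtenInExtChartAt f x)
    (fun z hz ↦ chartMetric_fderiv_writtenInExtChartAt hf x hz) (mem_chartDomain f x) u v
  rw [writtenInExtChartAt_self] at h
  rw [sectionalCurvature_eq_chart, sectionalCurvature_eq_chart, ← chartMetric_self (f x),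
    ← chartMetric_self (f x), ambientDeriv_eq, ambientDeriv_eq, ambientDeriv_eq,
    mfderiv_eq_fderiv_writtenInExtChartAt hf.1]
  exact h

theorem ambientDeriv_comm
    [IsContMDiffRiemannianBundle 𝓘(ℝ, E') ∞ E' (fun x : M' ↦ TangentSpace 𝓘(ℝ, E') x)]
    {f : M → M'} (hf : ContMDiff 𝓘(ℝ, E) 𝓘(ℝ, E') ∞ f) (x : M)
    (u v : TangentSpace 𝓘(ℝ, E) x) :
    ambientDeriv (E' := E') f x u v = ambientDeriv (E' := E') f x v u := by
  rw [ambientDeriv_eq, ambientDeriv_eq]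
  exact covDerivAlong_fderiv_comm (isRiemannianOn_chartMetric (E := E') (f x))
    (mapsTo_writtenInExtChartAt f x (mem_chartDomain f x))
    (contDiffAt_writtenInExtChartAt hf x (mem_chartDomain f x)) u v

/-- For `v` constant in the chart the derivative is D²F(u, v) + Γ'(DF u, DF v). -/
theorem exists_bilin_ambientDeriv {f : M → M'} (hf : ContMDiff 𝓘(ℝ, E) 𝓘(ℝ, E') ∞ f) (x : M) :
    ∃ b : TangentSpace 𝓘(ℝ, E) x →ₗ[ℝ] TangentSpace 𝓘(ℝ, E) x →ₗ[ℝ] TangentSpace 𝓘(ℝ, E') (f x),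
      ∀ u v, ambientDeriv (E' := E') f x u v = b u v := by
  have h : ∃ b : E →ₗ[ℝ] E →ₗ[ℝ] E', ∀ u v : E, covDerivAlong (chartMetric (E := E') (f x))
      (writtenInExtChartAt 𝓘(ℝ, E) 𝓘(ℝ, E') x f)
      (fun z ↦ fderiv ℝ (writtenInExtChartAt 𝓘(ℝ, E) 𝓘(ℝ, E') x f) z v) u
      (extChartAt 𝓘(ℝ, E) x x) = b u v := by
    have hF := contDiffAt_writtenInExtChartAt hf x (mem_chartDomain f x)
    generalize writtenInExtChartAt 𝓘(ℝ, E) 𝓘(ℝ, E') x f = F at hF ⊢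
    generalize extChartAt 𝓘(ℝ, E) x x = y at hF ⊢
    have hd : DifferentiableAt ℝ (fderiv ℝ F) y :=
      (hF.fderiv_right (m := ∞) (by simp)).differentiableAt (by simp)
    have hdd : ∀ u v, fderiv ℝ (fun z ↦ fderiv ℝ F z v) y u = fderiv ℝ (fderiv ℝ F) y u v := by
      intro u v
      rw [(hd.hasFDerivAt.clm_apply (hasFDerivAt_const v y)).fderiv]
      simp
    refine ⟨LinearMap.mk₂ ℝ (fun u v ↦ fderiv ℝ (fderiv ℝ F) y u v + christoffelL
      (chartMetric (E := E') (f x)) (F y) (fderiv ℝ F y u) (fderiv ℝ F y v)) ?_ ?_ ?_ ?_,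
      fun u v ↦ by rw [covDerivAlong, hdd]; rfl⟩
    all_goals
      intros
      simp only [map_add, map_smul, add_apply, smul_apply, smul_add]
    all_goals abel
  obtain ⟨b, hb⟩ := h
  exact ⟨b, fun u v ↦ (ambientDeriv_eq f x u v).trans (hb u v)⟩

theorem exists_bilin_secondFundamentalForm {f : M → M'}
    (hf : ContMDiff 𝓘(ℝ, E) 𝓘(ℝ, E') ∞ f) (x : M) :
    ∃ b : TangentSpace 𝓘(ℝ, E) x →ₗ[ℝ] TangentSpace 𝓘(ℝ, E) x →ₗ[ℝ] TangentSpace 𝓘(ℝ, E') (f x),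
      ∀ u v, secondFundamentalForm (E' := E') f x u v = b u v := by
  obtain ⟨b, hb⟩ := exists_bilin_ambientDeriv hf x
  let e := stdOrthonormalBasis ℝ (TangentSpace 𝓘(ℝ, E) x)
  let φ := mfderiv 𝓘(ℝ, E) 𝓘(ℝ, E') f x
  let N : TangentSpace 𝓘(ℝ, E') (f x) →ₗ[ℝ] TangentSpace 𝓘(ℝ, E') (f x) :=
    LinearMap.id - ∑ a, (innerₗ _ (φ (e a))).smulRight (φ (e a))
  refine ⟨b.compr₂ N, fun u v ↦ ?_⟩
  rw [secondFundamentalForm, normalPart, hb]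
  simp [N, φ, e]

/-- Pythagoras for the projection onto the orthogonal complement of an orthonormal family. -/
theorem Orthonormal.inner_sub_sum_sub_sum {N : Type*} [NormedAddCommGroup N]
    [InnerProductSpace ℝ N] {ι : Type*} [Fintype ι] {g : ι → N} (hg : Orthonormal ℝ g)
    (w w' : N) :
    (inner ℝ (w - ∑ a, (inner ℝ (g a) w : ℝ) • g a) (w' - ∑ a, (inner ℝ (g a) w' : ℝ) • g a) : ℝ) =
      inner ℝ w w' - ∑ a, (inner ℝ (g a) w : ℝ) * inner ℝ (g a) w' := by
  have h1 : (inner ℝ w (∑ a, (inner ℝ (g a) w' : ℝ) • g a) : ℝ) =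
      ∑ a, (inner ℝ (g a) w : ℝ) * inner ℝ (g a) w' := by
    rw [inner_sum]
    refine Finset.sum_congr rfl fun a _ ↦ ?_
    rw [real_inner_smul_right, real_inner_comm w, mul_comm]
  have h2 : (inner ℝ (∑ a, (inner ℝ (g a) w : ℝ) • g a) w' : ℝ) =
      ∑ a, (inner ℝ (g a) w : ℝ) * inner ℝ (g a) w' := by
    rw [sum_inner]
    exact Finset.sum_congr rfl fun a _ ↦ real_inner_smul_left _ _ _
  have h3 := hg.inner_sum (fun a ↦ (inner ℝ (g a) w : ℝ)) (fun a ↦ (inner ℝ (g a) w' : ℝ))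
    Finset.univ
  simp only [conj_trivial] at h3
  rw [inner_sub_left, inner_sub_right, inner_sub_right, h1, h2, h3]
  ring

theorem inner_normalPart {f : M → M'} (hf : IsIsometricImmersion (E := E) (E' := E') f) (x : M)
    (w w' : TangentSpace 𝓘(ℝ, E') (f x)) :
    (inner ℝ (normalPart (E := E) f x w) (normalPart (E := E) f x w') : ℝ) = inner ℝ w w' -
      ∑ a, (inner ℝ (mfderiv 𝓘(ℝ, E) 𝓘(ℝ, E') f x
        (stdOrthonormalBasis ℝ (TangentSpace 𝓘(ℝ, E) x) a)) w : ℝ) *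
      inner ℝ (mfderiv 𝓘(ℝ, E) 𝓘(ℝ, E') f x
        (stdOrthonormalBasis ℝ (TangentSpace 𝓘(ℝ, E) x) a)) w' := by
  refine Orthonormal.inner_sub_sum_sub_sum ?_ w w'
  rw [orthonormal_iff_ite]
  intro i j
  rw [hf.2]
  exact orthonormal_iff_ite.1 (stdOrthonormalBasis ℝ (TangentSpace 𝓘(ℝ, E) x)).orthonormal i j

/-- The Gauss equation. -/
theorem sectionalCurvature_gauss
    [IsContMDiffRiemannianBundle 𝓘(ℝ, E) ∞ E (fun x : M ↦ TangentSpace 𝓘(ℝ, E) x)]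
    [IsContMDiffRiemannianBundle 𝓘(ℝ, E') ∞ E' (fun x : M' ↦ TangentSpace 𝓘(ℝ, E') x)]
    {f : M → M'} (hf : IsIsometricImmersion (E := E) (E' := E') f) (x : M)
    (u v : TangentSpace 𝓘(ℝ, E) x) :
    sectionalCurvature x u v = sectionalCurvature (f x) (mfderiv 𝓘(ℝ, E) 𝓘(ℝ, E') f x u)
        (mfderiv 𝓘(ℝ, E) 𝓘(ℝ, E') f x v) +
      inner ℝ (secondFundamentalForm (E' := E') f x u u)
        (secondFundamentalForm (E' := E') f x v v) -
      ‖secondFundamentalForm (E' := E') f x u v‖ ^ 2 := by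
  -- Normal projection subtracts the pairing of tangential components, which Parseval (`key`)
  -- collapses to the pairing of intrinsic Christoffel terms; these are the corrections in
  -- `sectionalCurvature_eq_ambient`.
  have h : ∀ a b c d : TangentSpace 𝓘(ℝ, E) x,
      (inner ℝ (secondFundamentalForm (E' := E') f x a b)
        (secondFundamentalForm (E' := E') f x c d) : ℝ) =
      inner ℝ (ambientDeriv (E' := E') f x a b) (ambientDeriv (E' := E') f x c d) -
      chartMetric (E := E) x (extChartAt 𝓘(ℝ, E) x x)
          (christoffelL (chartMetric (E := E) x) (extChartAt 𝓘(ℝ, E) x x) a b)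
          (christoffelL (chartMetric (E := E) x) (extChartAt 𝓘(ℝ, E) x x) c d) := by
    intro a b c d
    rw [secondFundamentalForm, secondFundamentalForm, inner_normalPart hf]
    simp only [inner_mfderiv_ambientDeriv hf]
    congr 1
    set e := stdOrthonormalBasis ℝ (TangentSpace 𝓘(ℝ, E) x)
    have key : ∀ p q : TangentSpace 𝓘(ℝ, E) x, ∑ i, chartMetric (E := E) x
        (extChartAt 𝓘(ℝ, E) x x) p (e i) * chartMetric (E := E) x (extChartAt 𝓘(ℝ, E) x x) q (e i)
        = chartMetric (E := E) x (extChartAt 𝓘(ℝ, E) x x) p q := by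
      intro p q
      refine Eq.trans ?_ ((e.sum_inner_mul_inner p q).trans (chartMetric_self x p q).symm)
      refine Finset.sum_congr rfl fun i _ ↦ ?_
      rw [chartMetric_self, chartMetric_self, real_inner_comm q]
    exact key _ _
  rw [← real_inner_self_eq_norm_sq, h, h, sectionalCurvature_eq_ambient hf, real_inner_comm,
    (isRiemannianOn_chartMetric (E := E) x).symm _ (mem_extChartAt_target x)
      (christoffelL (chartMetric (E := E) x) (extChartAt 𝓘(ℝ, E) x x) u u)]

end Immersion

/-! ### The main theorem. -/

theorem theorem1
    {E : Type*} [NormedAddCommGroup E] [NormedSpace ℝ E] [FiniteDimensional ℝ E]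
    {M : Type*} [TopologicalSpace M] [ChartedSpace E M] [IsManifold 𝓘(ℝ, E) ∞ M]
    [RiemannianBundle (fun x : M ↦ TangentSpace 𝓘(ℝ, E) x)]
    [IsContMDiffRiemannianBundle 𝓘(ℝ, E) ∞ E (fun x : M ↦ TangentSpace 𝓘(ℝ, E) x)]
    {E' : Type*} [NormedAddCommGroup E'] [NormedSpace ℝ E'] [FiniteDimensional ℝ E']
    {M' : Type*} [TopologicalSpace M'] [ChartedSpace E' M'] [IsManifold 𝓘(ℝ, E') ∞ M']
    [RiemannianBundle (fun x : M' ↦ TangentSpace 𝓘(ℝ, E') x)]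
    [IsContMDiffRiemannianBundle 𝓘(ℝ, E') ∞ E' (fun x : M' ↦ TangentSpace 𝓘(ℝ, E') x)]
    {d d' k : ℕ} (D : SmoothDistribution E M d) (D' : SmoothDistribution E' M' d')
    (f : M → M') (hf : IsIsometricImmersion (E := E) (E' := E') f)
    (hD : ∀ x : M, ∀ u ∈ D.fiber x, mfderiv 𝓘(ℝ, E) 𝓘(ℝ, E') f x u ∈ D'.fiber (f x))
    (hk : 2 ≤ k) (n : Fin k → ℕ) (hn : ∀ i, 1 ≤ n i) (hs : ∑ i, n i ≤ d) (x : M) :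
    -- the maxima in the definitions of the invariants exist
    IsGreatest (mutualCurvatureValues x (D.fiber x) n) (deltaPlus x (D.fiber x) n) ∧
    IsGreatest (mutualCurvatureValues (f x) (D'.fiber (f x)) n)
      (deltaPlus (f x) (D'.fiber (f x)) n) ∧
    IsGreatest (meanCurvatureNorms (E' := E') f x (D.fiber x) (∑ i, n i))
      (maxMeanCurvature (E' := E') f x (D.fiber x) (∑ i, n i)) ∧
    -- the inequality
    deltaPlus x (D.fiber x) n ≤ curvatureBound f D D' n x ∧
    -- the case of equality
    (deltaPlus x (D.fiber x) n = curvatureBound f D D' n x ↔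
      ∃ V : Fin k → Submodule ℝ (TangentSpace 𝓘(ℝ, E) x),
        IsOrthogonalTuple x (D.fiber x) n V ∧
        IsMixedTotallyGeodesic (E' := E') f x V ∧
        (∀ i j, meanCurvature (E' := E') f x (V i) = meanCurvature (E' := E') f x (V j)) ∧
        ‖meanCurvature (E' := E') f x (⨆ i, V i)‖ =
          maxMeanCurvature (E' := E') f x (D.fiber x) (∑ i, n i) ∧
        mutualCurvature (f x)
            (fun i ↦ (V i).map (mfderiv 𝓘(ℝ, E) 𝓘(ℝ, E') f x).toLinearMap) =
          deltaPlus (f x) (D'.fiber (f x)) n) := by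
  set φ : TangentSpace 𝓘(ℝ, E) x →ₗ[ℝ] TangentSpace 𝓘(ℝ, E') (f x) :=
    (mfderiv 𝓘(ℝ, E) 𝓘(ℝ, E') f x).toLinearMap
  have hφ : ∀ u v, (inner ℝ (φ u) (φ v) : ℝ) = inner ℝ u v := hf.2 x
  have hφD : ∀ u ∈ D.fiber x, φ u ∈ D'.fiber (f x) := hD x
  obtain ⟨h, hh⟩ := exists_bilin_secondFundamentalForm hf.1 x
  have hsymm : ∀ u v, h u v = h v u := fun u v ↦ by
    rw [← hh, ← hh, secondFundamentalForm, secondFundamentalForm, ambientDeriv_comm hf.1]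
  have hmean : ∀ V, meanCurvature (E' := E') f x V = traceOn h V := fun V ↦
    Finset.sum_congr rfl fun a _ ↦ hh _ _
  have hgauss : ∀ u v, sectionalCurvature x u v = sectionalCurvature (f x) (φ u) (φ v) +
      inner ℝ (h u u) (h v v) - ‖h u v‖ ^ 2 := fun u v ↦ by
    rw [← hh, ← hh, ← hh]
    exact sectionalCurvature_gauss hf x u v
  have hK := isBiquadratic_sectionalCurvature (E := E) x
  have hK' := isBiquadratic_sectionalCurvature (E := E') (f x)
  have hW := D.finrank_fiber x
  have hW' := D'.finrank_fiber (f x)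
  -- The differential embeds D in D', so s ≤ d'. Admissible tuples therefore exist in D' too, and
  -- the ambient supremum is attained rather than the default value of an empty `sSup`.
  have hdd : d ≤ d' := by
    have hinj : Function.Injective φ := by
      rw [← LinearMap.ker_eq_bot, LinearMap.ker_eq_bot']
      intro u hu
      rw [← inner_self_eq_zero (𝕜 := ℝ), ← hφ, hu, inner_zero_left]
    rw [← hW, ← hW', (Submodule.equivMapOfInjective φ hinj (D.fiber x)).finrank_eq]
    exact Submodule.finrank_mono (Submodule.map_le_iff_le_comap.2 hφD)
  have hδ : IsGreatest (mutualCurvatureValues x (D.fiber x) n) (deltaPlus x (D.fiber x) n) :=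
    hK.isGreatest_mutualSum (D.fiber x) n (hs.trans hW.ge)
  have hδ' : IsGreatest (mutualCurvatureValues (f x) (D'.fiber (f x)) n)
      (deltaPlus (f x) (D'.fiber (f x)) n) :=
    hK'.isGreatest_mutualSum (D'.fiber (f x)) n ((hs.trans hdd).trans hW'.ge)
  have hnorms : meanCurvatureNorms (E' := E') f x (D.fiber x) (∑ i, n i) =
      {r | ∃ V : Submodule ℝ (TangentSpace 𝓘(ℝ, E) x), V ≤ D.fiber x ∧
        Module.finrank ℝ V = ∑ i, n i ∧ r = ‖traceOn h V‖} := by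
    simp only [meanCurvatureNorms, hmean]
  have hm : IsGreatest (meanCurvatureNorms (E' := E') f x (D.fiber x) (∑ i, n i))
      (maxMeanCurvature (E' := E') f x (D.fiber x) (∑ i, n i)) := by
    rw [maxMeanCurvature, hnorms]
    exact isGreatest_norm_traceOn h (D.fiber x) (hs.trans hW.ge)
  -- Both cases of the bound involve the maximal mean curvature: if s = d, the only s-dimensional
  -- subspace of D is D.
  have hbound : curvatureBound f D D' n x = deltaPlus (f x) (D'.fiber (f x)) n +
      ((k : ℝ) - 1) / (2 * k) * maxMeanCurvature (E' := E') f x (D.fiber x) (∑ i, n i) ^ 2 := by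
    rw [curvatureBound]
    split_ifs with hlt
    · rfl
    · obtain ⟨V, hVD, hV, hVm⟩ := hm.1
      have hVeq : V = D.fiber x :=
        Submodule.eq_of_le_of_finrank_eq hVD (by omega)
      rw [hVm, hVeq]
  have hmain := sSup_mutualSum_le_of_gauss hk hK hK' hφ hsymm hgauss hφD hδ hδ' (hnorms ▸ hm)
  refine ⟨hδ, hδ', hm, hbound ▸ hmain.1, ?_⟩
  rw [hbound]
  refine hmain.2.trans (exists_congr fun V ↦ ?_)
  simp only [hmean, IsMixedTotallyGeodesic, hh]
  rfl
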